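/- A $d$-polytope is a nonempty convex hull $P$ of finitely many points of a finite-dimensional real vector space, of affine dimension $d$; a facet is a $(d-1)$-dimensional face. $P$ is \emph{2-simplicial} if each of its 2-dimensional faces is a triangle, and \emph{2-neighborly} if the segment between any two distinct vertices of $P$ is an edge (1-face) of $P$. A \emph{pyramid} over a polytope $Q$ is the convex hull of $Q$ and a point outside the affine hull of $Q$; a $0$-fold pyramid over $B$ is $B$ itself, and an $(r+1)$-fold pyramid over $B$ is a pyramid over an $r$-fold pyramid over $B$. A \emph{triangular bipyramid} is the convex hull of a triangle and a nondegenerate segment that meet in exactly one point, which lies in the relative interior of both. (1) Let $d \ge 3$. Every 2-simplicial $d$-polytope with at least $d+3$ vertices has at least $d+4$ facets. (2) Let $d \ge 3$. Every 2-simplicial $d$-polytope with at most $d+3$ facets is a $d$-simplex or a $(d-3)$-fold pyramid over a triangular bipyramid. (3) Every vertex of a 2-neighborly $d$-polytope with at least $d+3$ vertices lies in at least $d+3$ facets. -/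

import Mathlib

namespace Polytopes

variable {E : Type*} [NormedAddCommGroup E] [NormedSpace ℝ E]

/-- `P` is a `d`-polytope: a nonempty convex hull of finitely many points, of affine dimension
`d`. The ambient space may have dimension larger than `d`. -/
structure IsPolytope (d : ℕ) (P : Set E) : Prop where
  exists_finset : ∃ s : Finset E, P = convexHull ℝ (s : Set E)
  nonempty : P.Nonempty
  finrank_eq : Module.finrank ℝ (vectorSpan ℝ P) = d

/-- `F` is a `k`-dimensional face of `P`: a nonempty set of the form `P ∩ H`, with `H` a
supporting hyperplane of `P`, or `P` itself (this is the case of the zero functional in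
`IsExposed`), whose affine dimension is `k`. -/
structure IsFace (k : ℕ) (P F : Set E) : Prop where
  nonempty : F.Nonempty
  isExposed : IsExposed ℝ P F
  finrank_eq : Module.finrank ℝ (vectorSpan ℝ F) = k

/-- The set of vertices of `P`. -/
def vertices (P : Set E) : Set E := P.extremePoints ℝ

/-- The set of facets of `P`: the faces whose dimension is one less than that of `P`. -/
def facets (P : Set E) : Set (Set E) :=
  {F | ∃ k, IsFace k P F ∧ Module.finrank ℝ (vectorSpan ℝ P) = k + 1}

/-- `S` is a `k`-simplex: the convex hull of `k + 1` affinely independent points. -/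
def IsSimplex (k : ℕ) (S : Set E) : Prop :=
  ∃ s : Finset E, s.card = k + 1 ∧ AffineIndependent ℝ ((↑) : s → E) ∧
    S = convexHull ℝ (s : Set E)

/-- `P` is `k`-simplicial: every `k`-face of `P` is a simplex. -/
def IsSimplicial (k : ℕ) (P : Set E) : Prop :=
  ∀ F : Set E, IsFace k P F → IsSimplex k F

/-- `P` is 2-neighborly: any two of its vertices form an edge. -/
def IsTwoNeighborly (P : Set E) : Prop :=
  ∀ v ∈ vertices P, ∀ w ∈ vertices P, v ≠ w → IsFace 1 P (segment ℝ v w)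

/-- `P` is a pyramid with base `Q`: the convex hull of `Q` and a point outside the affine hull
of `Q`. -/
def IsPyramid (Q P : Set E) : Prop :=
  ∃ a : E, a ∉ affineSpan ℝ Q ∧ P = convexHull ℝ (insert a Q)

/-- `P` is an `r`-fold pyramid over `B`. -/
def IsFoldPyramid (B : Set E) : ℕ → Set E → Prop
  | 0, P => P = B
  | r + 1, P => ∃ Q : Set E, IsFoldPyramid B r Q ∧ IsPyramid Q P

/-- `B` is a triangular bipyramid: the convex hull of a triangle `T` and a nondegenerate segment
which meet in exactly one point, this point lying in the relative interior of both. -/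
def IsTriangularBipyramid (B : Set E) : Prop :=
  ∃ (T : Set E) (a b x : E), IsSimplex 2 T ∧ a ≠ b ∧ segment ℝ a b ∩ T = {x} ∧
    x ∈ openSegment ℝ a b ∧ x ∈ intrinsicInterior ℝ T ∧
    B = convexHull ℝ (insert a (insert b T))

end Polytopes

/-! All three claims follow from one statement about a pointed polyhedral cone of dimension D ≥ 3
none of whose 3-dimensional faces has more than three extreme rays
(`FacetSystem.isBasisOrBipyramidal`). If it has at most D + 2 facets, then its rays form a basis, or
there are D + 1 of them and the cone is an iterated pyramid over the cone on a triangular bipyramid.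

For (1) and (2) the cone is spanned by P × {1}, with D = d + 1. For (3) it is spanned by the
directions from v to the other vertices, with D = d; since every vertex is joined to v by an edge,
each direction is an extreme ray, and Radon's theorem makes any five vertices affinely independent,
which bounds the 3-dimensional faces. If v were in at most d + 2 facets, there would be at most d +
1 directions, so at most d + 2 vertices.

The cone statement rests on `FacetSystem.exists_common_opposite`: two neighbours of a ray v, each
leaving a single facet through v, lie on a common facet that avoids v. This yields a simple ray v,
on exactly D - 1 facets (`exists_simple_generator`); v and its neighbours w i form a basis, and at
most three facets avoid v. If one of these contains every w i, there are no further rays. Otherwise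
any two w i share one of them, which forces three facets missing disjoint sets of w i. Two elements
in one such set would create a quadrilateral face, so each set is a singleton. Then a single ray z
remains beyond the span of the w i, and its coordinates give the bipyramid relation. -/

namespace Polytopes

open Finset Module

/-! ### Cones given by generators and irredundant facet inequalities. -/

section Cone

variable {W A ι : Type*} [AddCommGroup W] [Module ℝ W] [Fintype A]

/-- `u` is a nonnegative combination of the vectors `x a`. -/
def InCone (x : A → W) (u : W) : Prop :=
  ∃ c : A → ℝ, (∀ a, 0 ≤ c a) ∧ ∑ a, c a • x a = u

/-- The cone generated by the vectors `x a`, no two of them proportional and each of them on an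
extreme ray, is cut out by the inequalities `0 ≤ f i`, none of which follows from another one. -/
structure FacetSystem (x : A → W) (f : ι → W →ₗ[ℝ] ℝ) : Prop where
  nonneg : ∀ i a, 0 ≤ f i (x a)
  mem : ∀ u, (∀ i, 0 ≤ f i u) → InCone x u
  irred : ∀ i j, i ≠ j → ∃ a, f i (x a) = 0 ∧ 0 < f j (x a)
  extreme : ∀ a u, (∀ i, f i (x a) = 0 → f i u = 0) → ∃ t : ℝ, u = t • x a
  proper : ∀ a, ∃ i, 0 < f i (x a)
  inj : ∀ a b (t : ℝ), x b = t • x a → a = b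

/-- Every face whose generators lie in a 3-dimensional space has at most three generators. -/
def FacesTriangular (x : A → W) (f : ι → W →ₗ[ℝ] ℝ) : Prop :=
  ∀ (S : Set ι) (e₁ e₂ e₃ : W),
    (∀ a, (∀ i ∈ S, f i (x a) = 0) → ∃ t₁ t₂ t₃ : ℝ, x a = t₁ • e₁ + t₂ • e₂ + t₃ • e₃) →
    ∀ a b c d : A, [a, b, c, d].Nodup → (∀ i ∈ S, f i (x a) = 0) → (∀ i ∈ S, f i (x b) = 0) →
      (∀ i ∈ S, f i (x c) = 0) → (∀ i ∈ S, f i (x d) = 0) → False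

/-- A short step is allowed as soon as the tight inequalities allow it. This is how points are moved
inside a cone below. -/
theorem exists_pos_forall_add_mul_nonneg [Finite ι] (p q : ι → ℝ) (hp : ∀ i, 0 ≤ p i)
    (hq : ∀ i, p i = 0 → 0 ≤ q i) : ∃ ε : ℝ, 0 < ε ∧ ∀ i, 0 ≤ p i + ε * q i := by
  have h : ∀ i, ∀ᶠ ε : ℝ in nhdsWithin 0 (Set.Ioi 0), 0 ≤ p i + ε * q i := by
    intro i
    rcases (hp i).eq_or_lt with h0 | h0
    · filter_upwards [self_mem_nhdsWithin] with ε hε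
      rw [← h0, zero_add]
      exact mul_nonneg (le_of_lt hε) (hq i h0.symm)
    · have hc : Filter.Tendsto (fun ε : ℝ => p i + ε * q i) (nhdsWithin 0 (Set.Ioi 0))
          (nhds (p i + 0 * q i)) :=
        ((by fun_prop : Continuous fun ε : ℝ => p i + ε * q i).tendsto 0).mono_left
          nhdsWithin_le_nhds
      exact (hc.eventually (lt_mem_nhds (by simpa using h0))).mono fun _ h => h.le
  obtain ⟨ε, h1, h2⟩ := ((Filter.eventually_all.2 h).and self_mem_nhdsWithin).exists
  exact ⟨ε, h2, h1⟩

namespace FacetSystem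

variable {x : A → W} {f : ι → W →ₗ[ℝ] ℝ}

theorem ne_zero (F : FacetSystem x f) (a : A) : x a ≠ 0 := by
  intro h
  obtain ⟨i, hi⟩ := F.proper a
  simp [h] at hi

theorem pos_of_ne (F : FacetSystem x f) {i : ι} {a : A} (h : f i (x a) ≠ 0) : 0 < f i (x a) :=
  lt_of_le_of_ne (F.nonneg i a) h.symm

theorem eq_of_zeros_subset (F : FacetSystem x f) {a b : A}
    (h : ∀ i, f i (x a) = 0 → f i (x b) = 0) : a = b := by
  obtain ⟨t, ht⟩ := F.extreme a (x b) h
  exact F.inj a b t ht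

/-- A point of the cone where `g` is negative lies in a face one of whose generators is negative
under `g`. -/
theorem exists_generator (F : FacetSystem x f) {u : W} (hu : ∀ i, 0 ≤ f i u)
    (g : W →ₗ[ℝ] ℝ) (hg : g u < 0) :
    ∃ a, g (x a) < 0 ∧ ∀ i, f i u = 0 → f i (x a) = 0 := by
  obtain ⟨c, hc, rfl⟩ := F.mem u hu
  simp only [map_sum, map_smul, smul_eq_mul] at hg ⊢
  obtain ⟨a, -, ha⟩ := Finset.exists_lt_of_sum_lt (s := univ) (f := fun a => c a * g (x a))
    (g := fun _ => (0 : ℝ)) (by simpa using hg)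
  have hca : 0 < c a := lt_of_le_of_ne (hc a) (by rintro h; simp [← h] at ha)
  refine ⟨a, by_contra fun h => absurd ha (not_lt.2 (mul_nonneg hca.le (not_lt.1 h))), ?_⟩
  intro i hi
  rw [Finset.sum_eq_zero_iff_of_nonneg fun b _ => mul_nonneg (hc b) (F.nonneg i b)] at hi
  simpa [hca.ne'] using hi a (mem_univ a)

/-- Without such a facet, y + y' - ε v would stay in the cone for small ε > 0, hence in the face
spanned by v, y, y'. Triangularity leaves this face no other generator, and the coefficient of v
would have to be -ε. -/
theorem exists_common_opposite [Finite ι] (F : FacetSystem x f) (T : FacesTriangular x f)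
    {v y y' : A} {p q : ι} (hp : f p (x v) = 0) (hq : f q (x v) = 0)
    (hpy : 0 < f p (x y)) (hpy' : f p (x y') = 0) (hqy : f q (x y) = 0) (hqy' : 0 < f q (x y'))
    (hN : ∀ i, f i (x v) = 0 → i ≠ p → i ≠ q → f i (x y) = 0 ∧ f i (x y') = 0) :
    ∃ r, 0 < f r (x v) ∧ f r (x y) = 0 ∧ f r (x y') = 0 := by
  classical
  by_contra! hcon
  let S : Set ι := {i | f i (x v) = 0 ∧ i ≠ p ∧ i ≠ q}
  obtain ⟨ε, hε, hpt⟩ := exists_pos_forall_add_mul_nonneg (fun i => f i (x y) + f i (x y'))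
    (fun i => - f i (x v)) (fun i => add_nonneg (F.nonneg i y) (F.nonneg i y')) (by
      intro i hi
      have h1 := F.nonneg i y
      have h2 := F.nonneg i y'
      by_contra! h
      exact hcon i (by linarith) (by linarith) (by linarith))
  obtain ⟨c, hc, hsum⟩ := F.mem (x y + x y' - ε • x v) (fun i => by
    have := hpt i
    simp only [map_sub, map_add, map_smul, smul_eq_mul]
    linarith)
  have hface : ∀ a, c a ≠ 0 → ∀ i ∈ S, f i (x a) = 0 := by
    rintro a ha i ⟨hi0, hip, hiq⟩
    have h := congrArg (f i) hsum
    obtain ⟨h1, h2⟩ := hN i hi0 hip hiq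
    simp only [map_sum, map_smul, smul_eq_mul, map_sub, map_add, h1, h2, hi0, mul_zero, add_zero,
      sub_zero] at h
    rw [Finset.sum_eq_zero_iff_of_nonneg fun b _ => mul_nonneg (hc b) (F.nonneg i b)] at h
    simpa [ha] using h a (mem_univ a)
  have hvy : v ≠ y := by rintro rfl; exact hpy.ne' hp
  have hvy' : v ≠ y' := by rintro rfl; exact hqy'.ne' hq
  have hyy' : y ≠ y' := by rintro rfl; exact hpy.ne' hpy'
  have hsub : ∀ a, (∀ i ∈ S, f i (x a) = 0) → a = v ∨ a = y ∨ a = y' := by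
    intro a ha
    by_contra! hne
    refine T S (x v) (x y) (x y') ?_ v y y' a ?_ (fun i hi => hi.1)
      (fun i hi => (hN i hi.1 hi.2.1 hi.2.2).1) (fun i hi => (hN i hi.1 hi.2.1 hi.2.2).2) ha
    · intro b hb
      -- Removing the y and y' parts, read off from `f p` and `f q`, leaves a vector on all facets
      -- through v.
      obtain ⟨t, ht⟩ := F.extreme v (x b - (f p (x b) / f p (x y)) • x y -
        (f q (x b) / f q (x y')) • x y') (by
          intro i hi
          simp only [map_sub, map_smul, smul_eq_mul]
          by_cases h1 : i = p
          · subst h1; rw [hpy']; field_simp; ring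
          by_cases h2 : i = q
          · subst h2; rw [hqy]; field_simp; ring
          rw [hb i ⟨hi, h1, h2⟩, (hN i hi h1 h2).1, (hN i hi h1 h2).2]; ring)
      refine ⟨t, f p (x b) / f p (x y), f q (x b) / f q (x y'), ?_⟩
      rw [← ht]; abel
    · simp [hvy, hvy', hyy', hne.1.symm, hne.2.1.symm, hne.2.2.symm]
  have hsum' : ∑ a, c a • x a = c v • x v + (c y • x y + c y' • x y') := by
    rw [← Finset.sum_subset (Finset.subset_univ ({v, y, y'} : Finset A)),
      Finset.sum_insert (by simp [hvy, hvy']), Finset.sum_insert (by simp [hyy']),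
      Finset.sum_singleton]
    intro a _ ha
    by_cases hca : c a = 0
    · simp [hca]
    · exact absurd (hsub a (hface a hca)) (by simpa using ha)
  rw [hsum'] at hsum
  have e1 := congrArg (f p) hsum
  have e2 := congrArg (f q) hsum
  simp only [map_sub, map_add, map_smul, smul_eq_mul, hp, hpy', hq, hqy] at e1 e2
  have c1 : c y = 1 := mul_right_cancel₀ hpy.ne' (by linarith)
  have c2 : c y' = 1 := mul_right_cancel₀ hqy'.ne' (by linarith)
  rw [c1, c2, one_smul, one_smul] at hsum
  obtain ⟨r, hr⟩ := F.proper v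
  have e3 := congrArg (f r) hsum
  simp only [map_sub, map_add, map_smul, smul_eq_mul] at e3
  have := hc v
  nlinarith [mul_nonneg this hr.le, mul_pos hε hr]

end FacetSystem

end Cone

/-! ### Existence of a simple generator, and coordinates there. -/

section Cone

variable {W A ι : Type*} [AddCommGroup W] [Module ℝ W] [Fintype A]

/-- At the generator `v`, the cone looks like an orthant: `v` and the generators `w i`, each of them
on all but one of the facets through `v`, form a basis, and `τ` is the coordinate of `v`. -/
structure Corner (x : A → W) (f : ι → W →ₗ[ℝ] ℝ) (v : A) [Fintype {i // f i (x v) = 0}]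
    (w : {i // f i (x v) = 0} → A) (τ : W →ₗ[ℝ] ℝ) : Prop where
  pos : ∀ i : {i // f i (x v) = 0}, 0 < f i (x (w i))
  zero : ∀ i j : {i // f i (x v) = 0}, i ≠ j → f i (x (w j)) = 0
  coord_self : τ (x v) = 1
  coord_other : ∀ i, τ (x (w i)) = 0
  expand : ∀ u, u = τ u • x v +
    ∑ i : {i // f i (x v) = 0}, (f i u / f i (x (w i))) • x (w i)

namespace FacetSystem

variable {x : A → W} {f : ι → W →ₗ[ℝ] ℝ}

theorem ker_pi_le_span (F : FacetSystem x f) (a : A) :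
    LinearMap.ker (LinearMap.pi fun i : {i // f i (x a) = 0} => f i) ≤ ℝ ∙ x a := by
  intro u hu
  obtain ⟨t, rfl⟩ := F.extreme a u fun i hi => congrFun (LinearMap.mem_ker.1 hu) ⟨i, hi⟩
  exact Submodule.smul_mem _ _ (Submodule.mem_span_singleton_self _)

theorem finrank_le_finrank_range [FiniteDimensional ℝ W] (F : FacetSystem x f) (a : A) :
    finrank ℝ W ≤ finrank ℝ (LinearMap.range
      (LinearMap.pi fun i : {i // f i (x a) = 0} => f i)) + 1 := by
  have h1 := LinearMap.finrank_range_add_finrank_ker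
    (LinearMap.pi fun i : {i // f i (x a) = 0} => f i)
  have h2 := Submodule.finrank_mono (F.ker_pi_le_span a)
  have h3 := finrank_span_singleton (K := ℝ) (F.ne_zero a)
  omega

theorem finrank_le_card_zeros [FiniteDimensional ℝ W] [Fintype ι] (F : FacetSystem x f) (a : A) :
    finrank ℝ W ≤ Nat.card {i // f i (x a) = 0} + 1 := by
  classical
  have h1 := F.finrank_le_finrank_range a
  have h2 := Submodule.finrank_le (LinearMap.range
      (LinearMap.pi fun i : {i // f i (x a) = 0} => f i))
  rw [finrank_fintype_fun_eq_card, ← Nat.card_eq_fintype_card] at h2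
  omega

omit [Fintype A] in
theorem card_zeros_add_card_nonzeros [Fintype ι] [DecidableEq ι] (a : A) :
    Nat.card {i // f i (x a) = 0} + #{i | f i (x a) ≠ 0} = Fintype.card ι := by
  rw [Nat.card_eq_fintype_card, Fintype.card_subtype]
  exact Finset.card_filter_add_card_filter_not _

/-- If every generator misses at most two facets, then it misses at most one. -/
theorem card_nonzeros_le_one [Fintype ι] [DecidableEq ι] (F : FacetSystem x f)
    (T : FacesTriangular x f) (h : ∀ a, #{i | f i (x a) ≠ 0} ≤ 2) (v : A) :
    #{i | f i (x v) ≠ 0} ≤ 1 := by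
  by_contra! hv
  obtain ⟨r, s, hrs, hM⟩ := Finset.card_eq_two.1 (le_antisymm (h v) hv)
  have hMv : ∀ i, f i (x v) ≠ 0 ↔ i = r ∨ i = s := by
    intro i; simpa using Finset.ext_iff.1 hM i
  -- a generator on the facet `s` outside the facet `r` misses one further facet only
  have key : ∀ r s, r ≠ s → (∀ i, f i (x v) ≠ 0 ↔ i = r ∨ i = s) → ∃ (y : A) (p : ι),
      0 < f r (x y) ∧ f s (x y) = 0 ∧ f p (x v) = 0 ∧ 0 < f p (x y) ∧
      ∀ i, f i (x v) = 0 → i ≠ p → f i (x y) = 0 := by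
    intro r s hrs hMv
    obtain ⟨y, hsy, hry⟩ := F.irred s r hrs.symm
    have hvy : v ≠ y := by rintro rfl; exact (hMv s).2 (Or.inr rfl) hsy
    obtain ⟨p, hpv, hpy⟩ : ∃ p, f p (x v) = 0 ∧ f p (x y) ≠ 0 := by
      by_contra! hcon
      exact hvy (F.eq_of_zeros_subset hcon)
    have hrp : r ≠ p := by rintro rfl; exact (hMv r).2 (Or.inl rfl) hpv
    refine ⟨y, p, hry, hsy, hpv, F.pos_of_ne hpy, fun i hi hip => ?_⟩
    by_contra hne
    have hir : i ≠ r := by rintro rfl; exact (hMv i).2 (Or.inl rfl) hi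
    have : ({r, p, i} : Finset ι) ⊆ ({i | f i (x y) ≠ 0} : Finset ι) := by
      intro j hj
      simp only [mem_insert, mem_singleton] at hj
      rcases hj with rfl | rfl | rfl <;> simp [hne, hpy, hry.ne']
    have h3 := (Finset.card_le_card this).trans (h y)
    rw [Finset.card_eq_three.2 ⟨r, p, i, hrp, hir.symm, Ne.symm hip, rfl⟩] at h3
    omega
  obtain ⟨y, p, hry, hsy, hpv, hpy, hN⟩ := key r s hrs hMv
  obtain ⟨y', q, hsy', hry', hqv, hqy', hN'⟩ := key s r hrs.symm fun i => (hMv i).trans or_comm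
  have hrv : 0 < f r (x v) := F.pos_of_ne ((hMv r).2 (Or.inl rfl))
  have hsv : 0 < f s (x v) := F.pos_of_ne ((hMv s).2 (Or.inr rfl))
  by_cases hpq : p = q
  -- The combination of y and y' killed by `f p` lies on all facets through v, so it is a multiple
  -- of v; the facets r and s give that multiple opposite signs.
  · subst hpq
    obtain ⟨t, ht⟩ := F.extreme v (f p (x y') • x y - f p (x y) • x y') (by
      intro i hi
      simp only [map_sub, map_smul, smul_eq_mul]
      by_cases hip : i = p
      · subst hip; ring
      · rw [hN i hi hip, hN' i hi hip]; ring)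
    have e1 := congrArg (f r) ht
    have e2 := congrArg (f s) ht
    simp only [map_sub, map_smul, smul_eq_mul, hsy, hry', mul_zero, sub_zero, zero_sub] at e1 e2
    have h1 : 0 < t * f r (x v) := e1 ▸ mul_pos hqy' hry
    have h2 : t * f s (x v) < 0 := e2 ▸ neg_neg_of_pos (mul_pos hpy hsy')
    have h3 : 0 < t := pos_of_mul_pos_left h1 hrv.le
    exact absurd h2 (not_lt.2 (mul_pos h3 hsv).le)
  · obtain ⟨j, hjv, hjy, hjy'⟩ := F.exists_common_opposite T hpv hqv hpy (hN' p hpv hpq)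
      (hN q hqv (Ne.symm hpq)) hqy' fun i hi hip hiq => ⟨hN i hi hip, hN' i hi hiq⟩
    rcases (hMv j).1 hjv.ne' with rfl | rfl
    · exact hry.ne' hjy
    · exact hsy'.ne' hjy'

/-- Otherwise every generator is on at least D facets, so it misses at most two, hence exactly one.
The facet functionals are then independent, so at most D in number, although any generator gives D +
1 facets. -/
theorem exists_simple_generator [FiniteDimensional ℝ W] [Fintype ι] [Nonempty A]
    (F : FacetSystem x f) (T : FacesTriangular x f) (hD : 2 ≤ finrank ℝ W)
    (hcard : Fintype.card ι ≤ finrank ℝ W + 2) :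
    ∃ v, Nat.card {i // f i (x v) = 0} + 1 = finrank ℝ W := by
  classical
  by_contra! hcon
  have hN : ∀ v, finrank ℝ W ≤ Nat.card {i // f i (x v) = 0} := fun v => by
    have h1 := F.finrank_le_card_zeros v
    have h2 := hcon v
    omega
  have hone : ∀ v, #{i | f i (x v) ≠ 0} ≤ 1 := F.card_nonzeros_le_one T fun v => by
    have h1 := card_zeros_add_card_nonzeros (x := x) (f := f) v
    have h2 := hN v
    omega
  obtain ⟨v⟩ := ‹Nonempty A›
  have hcv := card_zeros_add_card_nonzeros (x := x) (f := f) v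
  have hv1 : 1 ≤ #{i | f i (x v) ≠ 0} := by
    obtain ⟨i, hi⟩ := F.proper v
    exact Finset.card_pos.2 ⟨i, by simp [hi.ne']⟩
  have hNv := hN v
  have : Nontrivial ι := Fintype.one_lt_card_iff_nontrivial.1 (by omega)
  -- A generator outside the facet j misses no other facet, so it isolates the coefficient of `f j`.
  have hli : LinearIndependent ℝ f := by
    rw [Fintype.linearIndependent_iff]
    intro g hg j
    obtain ⟨i, hij⟩ := exists_ne j
    obtain ⟨a, -, hja⟩ := F.irred i j hij
    have h0 := LinearMap.congr_fun hg (x a)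
    rw [LinearMap.sum_apply, Finset.sum_eq_single j] at h0
    · simpa [hja.ne'] using h0
    · intro k _ hkj
      by_cases hk : f k (x a) = 0
      · simp [hk]
      · exact absurd (Finset.card_le_one.1 (hone a) k (by simp [hk]) j (by simp [hja.ne'])) hkj
    · simp
  have h4 := hli.fintype_card_le_finrank
  rw [Subspace.dual_finrank_eq] at h4
  omega

theorem exists_corner [FiniteDimensional ℝ W] [Fintype ι] [Nonempty A]
    (F : FacetSystem x f) (T : FacesTriangular x f) (hD : 2 ≤ finrank ℝ W)
    (hcard : Fintype.card ι ≤ finrank ℝ W + 2) :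
    ∃ (v : A) (_ : Fintype {i // f i (x v) = 0}) (w : {i // f i (x v) = 0} → A)
      (τ : W →ₗ[ℝ] ℝ), Fintype.card {i // f i (x v) = 0} + 1 = finrank ℝ W ∧
        Corner x f v w τ := by
  classical
  obtain ⟨v, hv⟩ := F.exists_simple_generator T hD hcard
  rw [Nat.card_eq_fintype_card] at hv
  let L := LinearMap.pi fun i : {i // f i (x v) = 0} => f i
  have hL : LinearMap.range L = ⊤ := by
    apply Submodule.eq_top_of_finrank_eq
    have h1 := F.finrank_le_finrank_range v
    have h2 := Submodule.finrank_le (LinearMap.range L)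
    rw [finrank_fintype_fun_eq_card] at h2 ⊢
    change finrank ℝ W ≤ finrank ℝ (LinearMap.range L) + 1 at h1
    omega
  have hw : ∀ j : {i // f i (x v) = 0}, ∃ a, 0 < f j (x a) ∧
      ∀ i : {i // f i (x v) = 0}, i ≠ j → f i (x a) = 0 := by
    intro j
    -- A short move from v along u leaves only the facet j among those through v, and a generator of
    -- the smallest face containing the new point must leave j too.
    obtain ⟨u, hu⟩ := LinearMap.range_eq_top.1 hL (Pi.single j 1)
    have hu' : ∀ i : {i // f i (x v) = 0}, f i u = (Pi.single j (1 : ℝ) : _ → ℝ) i :=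
      fun i => congrFun hu i
    obtain ⟨ε, hε, hpt⟩ := exists_pos_forall_add_mul_nonneg (fun i => f i (x v))
      (fun i => f i u) (fun i => F.nonneg i v) (by
        intro i hi
        rw [hu' ⟨i, hi⟩, Pi.single_apply]
        split_ifs <;> norm_num)
    obtain ⟨a, ha, ha'⟩ := F.exists_generator (u := x v + ε • u) (fun i => by simpa using hpt i)
      (-f j) (by simp [j.2, hu' j, hε])
    refine ⟨a, by simpa using ha, fun i hij => ha' i ?_⟩
    simp [i.2, hu' i, hij]
  choose w hw1 hw2 using hw
  obtain ⟨r, hr⟩ := F.proper v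
  -- The sum cancels `f r` at each w i and vanishes at v; the factor normalizes the value at v.
  let τ : W →ₗ[ℝ] ℝ := (f r (x v))⁻¹ • (f r - ∑ j, (f r (x (w j)) / f j (x (w j))) • f j)
  have hτ : ∀ u, τ u = (f r (x v))⁻¹ *
      (f r u - ∑ j : {i // f i (x v) = 0}, f r (x (w j)) / f j (x (w j)) * f j u) := by
    intro u; simp [τ, LinearMap.sum_apply]
  have hτv : τ (x v) = 1 := by
    rw [hτ, Finset.sum_eq_zero fun j _ => by rw [j.2, mul_zero], sub_zero, inv_mul_cancel₀ hr.ne']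
  have hτw : ∀ i, τ (x (w i)) = 0 := by
    intro i
    rw [hτ, Finset.sum_eq_single i (fun j _ hj => by rw [hw2 _ _ hj, mul_zero]) (by simp),
      div_mul_cancel₀ _ (hw1 i).ne', sub_self, mul_zero]
  refine ⟨v, inferInstance, w, τ, hv, hw1, fun i j h => hw2 j i h, hτv, hτw, fun u => ?_⟩
  obtain ⟨t, ht⟩ := F.extreme v (u - ∑ i : {i // f i (x v) = 0}, (f i u / f i (x (w i))) • x (w i))
    (by
      intro i hi
      rw [map_sub, map_sum, Finset.sum_eq_single (⟨i, hi⟩ : {i // f i (x v) = 0})]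
      · rw [map_smul, smul_eq_mul, div_mul_cancel₀ _ (hw1 ⟨i, hi⟩).ne', sub_self]
      · intro j _ hj
        rw [map_smul, hw2 j ⟨i, hi⟩ (Ne.symm hj), smul_zero]
      · simp)
  have h1 := congrArg τ ht
  rw [map_sub, map_sum, Finset.sum_eq_zero fun i _ => by rw [map_smul, hτw, smul_zero], map_smul,
    hτv, sub_zero, smul_eq_mul, mul_one] at h1
  rw [h1, ← ht]; abel

end FacetSystem

end Cone

/-! ### Facets and generators away from a simple generator. -/

section Cone

variable {W A ι : Type*} [AddCommGroup W] [Module ℝ W] [Fintype A]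
  {x : A → W} {f : ι → W →ₗ[ℝ] ℝ}

/-- If any two elements are avoided by one of at most three nonempty sets, then there are exactly
three sets, and they are pairwise disjoint. -/
theorem exists_three_disjoint_of_pairs_avoided {J R : Type*} [Nontrivial J] (M : Finset R)
    (hM : #M ≤ 3) (B : R → J → Prop) (hB : ∀ r ∈ M, ∃ i, B r i)
    (h : ∀ i j, i ≠ j → ∃ r ∈ M, ¬ B r i ∧ ¬ B r j) :
    ∃ r₁ r₂ r₃, r₁ ≠ r₂ ∧ r₁ ≠ r₃ ∧ r₂ ≠ r₃ ∧ (∀ r, r ∈ M ↔ r = r₁ ∨ r = r₂ ∨ r = r₃) ∧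
      (∀ i, B r₁ i → ¬ B r₂ i ∧ ¬ B r₃ i) ∧ (∀ i, B r₂ i → ¬ B r₁ i ∧ ¬ B r₃ i) ∧
      (∀ i, B r₃ i → ¬ B r₁ i ∧ ¬ B r₂ i) := by
  classical
  obtain ⟨a, b, hab⟩ := exists_pair_ne J
  obtain ⟨r₁, h₁, -, -⟩ := h a b hab
  -- Each new set avoids an element of every earlier one, so the three sets found are distinct and
  -- exhaust M.
  obtain ⟨i₁, hi₁⟩ := hB r₁ h₁
  obtain ⟨j, hj⟩ := exists_ne i₁
  obtain ⟨r₂, h₂, hr₂, -⟩ := h i₁ j hj.symm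
  obtain ⟨i₂, hi₂⟩ := hB r₂ h₂
  have h12 : i₁ ≠ i₂ := by rintro rfl; exact hr₂ hi₂
  obtain ⟨r₃, h₃, h31, h32⟩ := h i₁ i₂ h12
  obtain ⟨i₃, hi₃⟩ := hB r₃ h₃
  have h13 : i₁ ≠ i₃ := by rintro rfl; exact h31 hi₃
  have h23 : i₂ ≠ i₃ := by rintro rfl; exact h32 hi₃
  have n12 : r₁ ≠ r₂ := by rintro rfl; exact hr₂ hi₁
  have n13 : r₁ ≠ r₃ := by rintro rfl; exact h31 hi₁
  have n23 : r₂ ≠ r₃ := by rintro rfl; exact h32 hi₂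
  have hsub : ({r₁, r₂, r₃} : Finset R) = M := Finset.eq_of_subset_of_card_le
    (by intro r; simp only [mem_insert, mem_singleton]; rintro (rfl | rfl | rfl) <;> assumption)
    (by rw [Finset.card_eq_three.2 ⟨r₁, r₂, r₃, n12, n13, n23, rfl⟩]; exact hM)
  have hmem : ∀ r, r ∈ M ↔ r = r₁ ∨ r = r₂ ∨ r = r₃ := by intro r; simp [← hsub]
  have h' : ∀ i j, i ≠ j → (¬ B r₁ i ∧ ¬ B r₁ j) ∨ (¬ B r₂ i ∧ ¬ B r₂ j) ∨
      (¬ B r₃ i ∧ ¬ B r₃ j) := by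
    intro i j hij
    obtain ⟨r, hr, hr'⟩ := h i j hij
    rcases (hmem r).1 hr with rfl | rfl | rfl
    exacts [Or.inl hr', Or.inr (Or.inl hr'), Or.inr (Or.inr hr')]
  -- A pair with one element in each of two sets can be avoided only by the third. Pairing an
  -- arbitrary i with i₁, i₂ or i₃ then gives disjointness in the same way.
  have k2 : ¬ B r₂ i₁ ∧ ¬ B r₂ i₃ := ((h' i₁ i₃ h13).resolve_left fun h => h.1 hi₁).resolve_right
    fun h => h.2 hi₃
  have k1 : ¬ B r₁ i₂ ∧ ¬ B r₁ i₃ := (h' i₂ i₃ h23).resolve_right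
    (not_or.2 ⟨fun h => h.1 hi₂, fun h => h.2 hi₃⟩)
  have ne : ∀ {r i j}, B r i → ¬ B r j → i ≠ j := by rintro r i _ h1 h2 rfl; exact h2 h1
  refine ⟨r₁, r₂, r₃, n12, n13, n23, hmem, fun i hi => ⟨?_, ?_⟩, fun i hi => ⟨?_, ?_⟩,
    fun i hi => ⟨?_, ?_⟩⟩
  · exact (((h' i i₃ (ne hi k1.2)).resolve_left fun h => h.1 hi).resolve_right fun h => h.2 hi₃).1
  · exact (((h' i i₂ (ne hi k1.1)).resolve_left fun h => h.1 hi).resolve_left fun h => h.2 hi₂).1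
  · exact ((h' i i₃ (ne hi k2.2)).resolve_right
      (not_or.2 ⟨fun h => h.1 hi, fun h => h.2 hi₃⟩)).1
  · exact (((h' i i₁ (ne hi k2.1)).resolve_left fun h => h.2 hi₁).resolve_left fun h => h.1 hi).1
  · exact ((h' i i₂ (ne hi h32)).resolve_right
      (not_or.2 ⟨fun h => h.2 hi₂, fun h => h.1 hi⟩)).1
  · exact (((h' i i₁ (ne hi h31)).resolve_left fun h => h.2 hi₁).resolve_right fun h => h.1 hi).1

namespace Corner

variable {v : A} [Fintype {i // f i (x v) = 0}] {w : {i // f i (x v) = 0} → A} {τ : W →ₗ[ℝ] ℝ}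

omit [Fintype A] in
theorem apply_eq (C : Corner x f v w τ) (g : W →ₗ[ℝ] ℝ) (u : W) :
    g u = τ u * g (x v) +
      ∑ i : {i // f i (x v) = 0}, f i u / f i (x (w i)) * g (x (w i)) := by
  conv_lhs => rw [C.expand u]
  simp

omit [Fintype A] in
theorem injective (C : Corner x f v w τ) : Function.Injective w := by
  intro i j hij
  by_contra h
  have := C.zero i j h
  rw [← hij] at this
  exact (C.pos i).ne' this

omit [Fintype A] in
theorem linearIndependent (C : Corner x f v w τ) :
    LinearIndependent ℝ fun o : Option {i // f i (x v) = 0} => x (o.elim v w) := by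
  classical
  rw [Fintype.linearIndependent_iff]
  intro g hg
  rw [Fintype.sum_option] at hg
  simp only [Option.elim_none, Option.elim_some] at hg
  have h0 : g none = 0 := by
    have := congrArg τ hg
    simpa [C.coord_self, C.coord_other] using this
  rintro (_ | i)
  · exact h0
  · have := congrArg (f i) hg
    rw [map_add, map_sum, Finset.sum_eq_single i (fun j _ hj => by
      rw [map_smul, C.zero i j hj.symm, smul_zero]) (by simp)] at this
    simpa [h0, (C.pos i).ne'] using this

/-- Such a generator is a nonnegative combination of v and the w i, so each facet through it
contains every term with a positive coefficient. Extremality identifies it with one of these terms.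
-/
theorem eq_of_coord_nonneg (C : Corner x f v w τ) (F : FacetSystem x f) {a : A}
    (ha : 0 ≤ τ (x a)) : a = v ∨ ∃ i, a = w i := by
  classical
  have hsum : ∀ r, f r (x a) = τ (x a) * f r (x v) +
      ∑ i : {i // f i (x v) = 0}, f i (x a) / f i (x (w i)) * f r (x (w i)) :=
    fun r => C.apply_eq (f r) (x a)
  have hnn : ∀ r, ∀ i : {i // f i (x v) = 0}, 0 ≤ f i (x a) / f i (x (w i)) * f r (x (w i)) :=
    fun r i => mul_nonneg (div_nonneg (F.nonneg _ _) (F.nonneg _ _)) (F.nonneg _ _)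
  by_cases h : ∃ i : {i // f i (x v) = 0}, f i (x a) ≠ 0
  · obtain ⟨i, hi⟩ := h
    refine Or.inr ⟨i, F.eq_of_zeros_subset fun r hr => ?_⟩
    have h1 := hsum r
    have h2 := Finset.single_le_sum (fun j _ => hnn r j) (mem_univ i)
    have h3 := mul_nonneg ha (F.nonneg r v)
    have h4 : f i (x a) / f i (x (w i)) * f r (x (w i)) = 0 := by
      have := hnn r i
      linarith
    exact (mul_eq_zero.1 h4).resolve_left (div_ne_zero hi (C.pos i).ne')
  · push Not at h
    refine Or.inl (F.eq_of_zeros_subset fun r hr => ?_)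
    have h1 := hsum r
    rw [Finset.sum_eq_zero fun i _ => by rw [h i, zero_div, zero_mul], add_zero, hr] at h1
    refine (mul_eq_zero.1 h1.symm).resolve_left fun h0 => F.ne_zero a ?_
    rw [C.expand (x a), h0, Finset.sum_eq_zero fun i _ => by rw [h i, zero_div, zero_smul]]
    simp

theorem exists_common_opposite [Finite ι] (C : Corner x f v w τ) (F : FacetSystem x f)
    (T : FacesTriangular x f) {i j : {i // f i (x v) = 0}} (hij : i ≠ j) :
    ∃ r, f r (x v) ≠ 0 ∧ f r (x (w i)) = 0 ∧ f r (x (w j)) = 0 := by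
  obtain ⟨r, h1, h2⟩ := F.exists_common_opposite T i.2 j.2 (C.pos i) (C.zero i j hij)
    (C.zero j i hij.symm) (C.pos j) fun k hk hki hkj =>
      ⟨C.zero ⟨k, hk⟩ i fun h => hki (congrArg Subtype.val h),
        C.zero ⟨k, hk⟩ j fun h => hkj (congrArg Subtype.val h)⟩
  exact ⟨r, h1.ne', h2⟩

end Corner

end Cone

/-! ### Classification of cones with few facets and triangular faces. -/

section Cone

variable {W A ι : Type*} [AddCommGroup W] [Module ℝ W] [Fintype A]
  {x : A → W} {f : ι → W →ₗ[ℝ] ℝ}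

/-- The facets avoiding the generator `v` are `r₁`, `r₂`, `r₃`, and each of the generators `w i`
lies on at least two of them. -/
structure ThreeOpposite (x : A → W) (f : ι → W →ₗ[ℝ] ℝ) (v : A)
    (w : {i // f i (x v) = 0} → A) (r₁ r₂ r₃ : ι) : Prop where
  mem : ∀ r, f r (x v) ≠ 0 ↔ r = r₁ ∨ r = r₂ ∨ r = r₃
  disj₁ : ∀ i, f r₁ (x (w i)) ≠ 0 → f r₂ (x (w i)) = 0 ∧ f r₃ (x (w i)) = 0
  disj₂ : ∀ i, f r₂ (x (w i)) ≠ 0 → f r₁ (x (w i)) = 0 ∧ f r₃ (x (w i)) = 0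
  disj₃ : ∀ i, f r₃ (x (w i)) ≠ 0 → f r₁ (x (w i)) = 0 ∧ f r₂ (x (w i)) = 0

namespace ThreeOpposite

variable {v : A} [Fintype {i // f i (x v) = 0}] {w : {i // f i (x v) = 0} → A} {τ : W →ₗ[ℝ] ℝ}
  {r₁ r₂ r₃ : ι}

omit [Fintype A] [Fintype {i // f i (x v) = 0}] in
theorem rotate (O : ThreeOpposite x f v w r₁ r₂ r₃) : ThreeOpposite x f v w r₂ r₃ r₁ where
  mem r := (O.mem r).trans (by tauto)
  disj₁ i h := (O.disj₂ i h).symm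
  disj₂ i h := (O.disj₃ i h).symm
  disj₃ i h := O.disj₁ i h

/-- The coefficients of u are chosen to put -v plus multiples of w i, w j, w k on all three facets
avoiding v. This u is in the cone and `τ u = -1`, so its smallest face has a generator with negative
`τ`. -/
theorem exists_opposite (O : ThreeOpposite x f v w r₁ r₂ r₃) (C : Corner x f v w τ)
    (F : FacetSystem x f) {i j k : {i // f i (x v) = 0}} (hi : f r₁ (x (w i)) ≠ 0)
    (hj : f r₂ (x (w j)) ≠ 0) (hk : f r₃ (x (w k)) ≠ 0) :
    ∃ a, τ (x a) < 0 ∧ (∀ r, f r (x v) ≠ 0 → f r (x a) = 0) ∧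
      ∀ l : {i // f i (x v) = 0}, l ≠ i → l ≠ j → l ≠ k → f l (x a) = 0 := by
  let u : W := -x v + (f r₁ (x v) / f r₁ (x (w i))) • x (w i) +
    (f r₂ (x v) / f r₂ (x (w j))) • x (w j) + (f r₃ (x v) / f r₃ (x (w k))) • x (w k)
  have hu : ∀ r, f r u = -f r (x v) + f r₁ (x v) / f r₁ (x (w i)) * f r (x (w i)) +
      f r₂ (x v) / f r₂ (x (w j)) * f r (x (w j)) +
      f r₃ (x v) / f r₃ (x (w k)) * f r (x (w k)) := by intro r; simp [u]
  have h0 : ∀ r, f r (x v) ≠ 0 → f r u = 0 := by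
    intro r hr
    rw [hu]
    rcases (O.mem r).1 hr with rfl | rfl | rfl
    · rw [(O.disj₂ j hj).1, (O.disj₃ k hk).1]; field_simp; ring
    · rw [(O.disj₁ i hi).1, (O.disj₃ k hk).2]; field_simp; ring
    · rw [(O.disj₁ i hi).2, (O.disj₂ j hj).2]; field_simp; ring
  obtain ⟨a, ha1, ha2⟩ := F.exists_generator (u := u) (fun r => by
    by_cases hr : f r (x v) = 0
    · rw [hu, hr, neg_zero, zero_add]
      exact add_nonneg (add_nonneg
        (mul_nonneg (div_nonneg (F.nonneg _ _) (F.nonneg _ _)) (F.nonneg _ _))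
        (mul_nonneg (div_nonneg (F.nonneg _ _) (F.nonneg _ _)) (F.nonneg _ _)))
        (mul_nonneg (div_nonneg (F.nonneg _ _) (F.nonneg _ _)) (F.nonneg _ _))
    · exact (h0 r hr).ge) τ (by simp [u, C.coord_self, C.coord_other])
  refine ⟨a, ha1, fun r hr => ha2 r (h0 r hr), fun l hli hlj hlk => ha2 l ?_⟩
  rw [hu, l.2, C.zero l i hli, C.zero l j hlj, C.zero l k hlk]
  simp

omit [Fintype A] in
/-- A coordinate of a vector on the facet `r`, if only one of its coordinates belongs to a
generator outside this facet. -/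
theorem _root_.Polytopes.Corner.coord_eq (C : Corner x f v w τ) {u : W} {r : ι}
    {j : {i // f i (x v) = 0}}
    (hj : f r (x (w j)) ≠ 0)
    (h : ∀ l : {i // f i (x v) = 0}, l ≠ j → f l u = 0 ∨ f r (x (w l)) = 0) (hr : f r u = 0) :
    f j u / f j (x (w j)) = - τ u * (f r (x v) / f r (x (w j))) := by
  have h1 := C.apply_eq (f r) u
  rw [hr, Finset.sum_eq_single j (fun l _ hl => by
    rcases h l hl with h | h
    · rw [h, zero_div, zero_mul]
    · rw [h, mul_zero]) (by simp)] at h1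
  rw [eq_comm, ← mul_div_assoc, div_eq_iff hj]
  linarith

/-- Two generators `w i` outside the facet `r₁` would belong to a quadrilateral face. -/
theorem subsingleton₁ (O : ThreeOpposite x f v w r₁ r₂ r₃) (C : Corner x f v w τ)
    (F : FacetSystem x f) (T : FacesTriangular x f) {i i' j k : {i // f i (x v) = 0}}
    (hi : f r₁ (x (w i)) ≠ 0) (hi' : f r₁ (x (w i')) ≠ 0)
    (hj : f r₂ (x (w j)) ≠ 0) (hk : f r₃ (x (w k)) ≠ 0) : i = i' := by
  classical
  by_contra hii
  have hv1 : f r₁ (x v) ≠ 0 := (O.mem _).2 (by simp)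
  have hv2 : f r₂ (x v) ≠ 0 := (O.mem _).2 (by simp)
  have hv3 : f r₃ (x v) ≠ 0 := (O.mem _).2 (by simp)
  have hij : i ≠ j := by rintro rfl; exact hj (O.disj₁ i hi).1
  have hik : i ≠ k := by rintro rfl; exact hk (O.disj₁ i hi).2
  have hij' : i' ≠ j := by rintro rfl; exact hj (O.disj₁ i' hi').1
  have hik' : i' ≠ k := by rintro rfl; exact hk (O.disj₁ i' hi').2
  have hjk : j ≠ k := by rintro rfl; exact hk (O.disj₂ j hj).2
  obtain ⟨a, ha, har, hal⟩ := O.exists_opposite C F hi hj hk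
  obtain ⟨b, hb, hbr, hbl⟩ := O.exists_opposite C F hi' hj hk
  -- If a = b, all coordinates at generators outside the facet r₁ vanish except that of v, so a
  -- would not be on r₁.
  have hab : a ≠ b := by
    rintro rfl
    have h1 := C.apply_eq (f r₁) (x a)
    rw [har r₁ hv1, Finset.sum_eq_zero, add_zero] at h1
    · exact (mul_ne_zero ha.ne hv1) h1.symm
    · intro l _
      by_cases hlj : l = j
      · subst hlj; rw [(O.disj₂ l hj).1, mul_zero]
      by_cases hlk : l = k
      · subst hlk; rw [(O.disj₃ l hk).1, mul_zero]
      by_cases hli : l = i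
      · subst hli; rw [hbl l hii hlj hlk, zero_div, zero_mul]
      · rw [hal l hli hlj hlk, zero_div, zero_mul]
  have hwa : ∀ l, w l ≠ a := by rintro l rfl; exact ha.ne (C.coord_other l)
  have hwb : ∀ l, w l ≠ b := by rintro l rfl; exact hb.ne (C.coord_other l)
  -- On this face the coordinates at j and k are multiples of `τ`, so it lies in a 3-dimensional
  -- space, yet it contains w i, w i', a and b.
  let S : Set ι := {r | r = r₂ ∨ r = r₃ ∨ ∃ l : {i // f i (x v) = 0},
    l.1 = r ∧ l ≠ i ∧ l ≠ i' ∧ l ≠ j ∧ l ≠ k}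
  refine T S (x (w i)) (x (w i')) (x v - (f r₂ (x v) / f r₂ (x (w j))) • x (w j) -
    (f r₃ (x v) / f r₃ (x (w k))) • x (w k)) ?_ (w i) (w i') a b ?_ ?_ ?_ ?_ ?_
  · intro c hc
    have hcl : ∀ l : {i // f i (x v) = 0}, l ≠ i → l ≠ i' → l ≠ j → l ≠ k → f l (x c) = 0 :=
      fun l h1 h2 h3 h4 => hc l (Or.inr (Or.inr ⟨l, rfl, h1, h2, h3, h4⟩))
    have hcj := C.coord_eq (u := x c) hj (fun l hl => by
      by_cases h1 : l = i
      · subst h1; exact Or.inr (O.disj₁ l hi).1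
      by_cases h2 : l = i'
      · subst h2; exact Or.inr (O.disj₁ l hi').1
      by_cases h3 : l = k
      · subst h3; exact Or.inr (O.disj₃ l hk).2
      exact Or.inl (hcl l h1 h2 hl h3)) (hc r₂ (Or.inl rfl))
    have hck := C.coord_eq (u := x c) hk (fun l hl => by
      by_cases h1 : l = i
      · subst h1; exact Or.inr (O.disj₁ l hi).2
      by_cases h2 : l = i'
      · subst h2; exact Or.inr (O.disj₁ l hi').2
      by_cases h3 : l = j
      · subst h3; exact Or.inr (O.disj₂ l hj).2
      exact Or.inl (hcl l h1 h2 h3 hl)) (hc r₃ (Or.inr (Or.inl rfl)))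
    refine ⟨f i (x c) / f i (x (w i)), f i' (x c) / f i' (x (w i')), τ (x c), ?_⟩
    conv_lhs => rw [C.expand (x c)]
    rw [← Finset.sum_subset (Finset.subset_univ ({i, i', j, k} : Finset _)),
      Finset.sum_insert (by simp [hii, hij, hik]), Finset.sum_insert (by simp [hij', hik']),
      Finset.sum_insert (by simp [hjk]), Finset.sum_singleton, hcj, hck]
    · module
    · intro l _ hl
      simp only [mem_insert, mem_singleton, not_or] at hl
      rw [hcl l hl.1 hl.2.1 hl.2.2.1 hl.2.2.2, zero_div, zero_smul]
  · have : w i ≠ w i' := fun h => hii (C.injective h)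
    simp [this, hwa, hwb, hab]
  · rintro r (rfl | rfl | ⟨l, rfl, h1, -⟩)
    exacts [(O.disj₁ i hi).1, (O.disj₁ i hi).2, C.zero l i h1]
  · rintro r (rfl | rfl | ⟨l, rfl, -, h1, -⟩)
    exacts [(O.disj₁ i' hi').1, (O.disj₁ i' hi').2, C.zero l i' h1]
  · rintro r (rfl | rfl | ⟨l, rfl, h1, h2, h3, h4⟩)
    exacts [har _ hv2, har _ hv3, hal l h1 h3 h4]
  · rintro r (rfl | rfl | ⟨l, rfl, h1, h2, h3, h4⟩)
    exacts [hbr _ hv2, hbr _ hv3, hbl l h2 h3 h4]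

end ThreeOpposite

/-- The generators are a basis, or they become one when `z` is removed, and `z` and another
generator `v` are opposite apexes of a bipyramid over the triangle `w₁`, `w₂`, `w₃`. -/
def IsBasisOrBipyramidal (x : A → W) : Prop :=
  (LinearIndependent ℝ x ∧ Fintype.card A = finrank ℝ W) ∨
    ∃ z v w₁ w₂ w₃ : A, [z, v, w₁, w₂, w₃].Nodup ∧
      LinearIndependent ℝ (fun a : {a // a ≠ z} => x a) ∧ Fintype.card A = finrank ℝ W + 1 ∧
      ∃ α β₁ β₂ β₃ : ℝ, 0 < α ∧ 0 < β₁ ∧ 0 < β₂ ∧ 0 < β₃ ∧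
        x z + α • x v = β₁ • x w₁ + β₂ • x w₂ + β₃ • x w₃

theorem FacetSystem.isBasisOrBipyramidal [FiniteDimensional ℝ W] [Fintype ι] [Nonempty A]
    (F : FacetSystem x f) (T : FacesTriangular x f) (hD : 3 ≤ finrank ℝ W)
    (hcard : Fintype.card ι ≤ finrank ℝ W + 2) : IsBasisOrBipyramidal x := by
  classical
  obtain ⟨v, hfin, w, τ, hv, C⟩ := F.exists_corner T (by omega) hcard
  have : Nontrivial {i // f i (x v) = 0} := Fintype.one_lt_card_iff_nontrivial.1 (by omega)
  let e : Option {i // f i (x v) = 0} → A := fun o => o.elim v w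
  have hli : LinearIndependent ℝ (x ∘ e) := C.linearIndependent
  have he : Function.Injective e := hli.injective.of_comp
  have hcardJ : Fintype.card (Option {i // f i (x v) = 0}) = finrank ℝ W := by
    rw [Fintype.card_option, hv]
  -- In the first case `f r` is a positive multiple of `τ`, so no generator has a negative
  -- coordinate.
  by_cases hcase : ∃ r, f r (x v) ≠ 0 ∧ ∀ i, f r (x (w i)) = 0
  · obtain ⟨r, hr, hrw⟩ := hcase
    have hsurj : Function.Surjective e := by
      intro a
      have h1 := C.apply_eq (f r) (x a)
      rw [Finset.sum_eq_zero fun i _ => by rw [hrw, mul_zero], add_zero] at h1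
      have h2 : 0 ≤ τ (x a) := by
        have := F.nonneg r a
        rw [h1] at this
        exact nonneg_of_mul_nonneg_left this (F.pos_of_ne hr)
      rcases C.eq_of_coord_nonneg F h2 with rfl | ⟨i, rfl⟩
      exacts [⟨none, rfl⟩, ⟨some i, rfl⟩]
    exact Or.inl ⟨(linearIndependent_equiv (Equiv.ofBijective e ⟨he, hsurj⟩)).1 hli,
      (Fintype.card_of_bijective ⟨he, hsurj⟩).symm.trans hcardJ⟩
  · push Not at hcase
    right
    -- Of the at most D + 2 facets, D - 1 contain v, which leaves at most three.
    obtain ⟨r₁, r₂, r₃, h12, h13, h23, hmem, d1, d2, d3⟩ :=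
      exists_three_disjoint_of_pairs_avoided (J := {i // f i (x v) = 0})
      ({r | f r (x v) ≠ 0} : Finset ι) (by
        have := card_zeros_add_card_nonzeros (x := x) (f := f) v
        rw [Nat.card_eq_fintype_card] at this
        omega) (fun r i => f r (x (w i)) ≠ 0) (by simpa using hcase) (by
          intro i j hij
          obtain ⟨r, hr⟩ := C.exists_common_opposite F T hij
          exact ⟨r, by simpa using hr⟩)
    have O : ThreeOpposite x f v w r₁ r₂ r₃ :=
      ⟨fun r => by simpa using hmem r, by simpa using d1, by simpa using d2, by simpa using d3⟩
    have hv1 : f r₁ (x v) ≠ 0 := (O.mem _).2 (by simp)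
    have hv2 : f r₂ (x v) ≠ 0 := (O.mem _).2 (by simp)
    have hv3 : f r₃ (x v) ≠ 0 := (O.mem _).2 (by simp)
    obtain ⟨i, hi⟩ := hcase r₁ hv1
    obtain ⟨j, hj⟩ := hcase r₂ hv2
    obtain ⟨k, hk⟩ := hcase r₃ hv3
    have hij : i ≠ j := by rintro rfl; exact hj (O.disj₁ i hi).1
    have hik : i ≠ k := by rintro rfl; exact hk (O.disj₁ i hi).2
    have hjk : j ≠ k := by rintro rfl; exact hk (O.disj₂ j hj).2
    have u1 : ∀ l, l ≠ i → f r₁ (x (w l)) = 0 := fun l hl =>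
      by_contra fun h => hl (O.subsingleton₁ C F T h hi hj hk)
    have u2 : ∀ l, l ≠ j → f r₂ (x (w l)) = 0 := fun l hl =>
      by_contra fun h => hl (O.rotate.subsingleton₁ C F T h hj hk hi)
    have u3 : ∀ l, l ≠ k → f r₃ (x (w l)) = 0 := fun l hl =>
      by_contra fun h => hl (O.rotate.rotate.subsingleton₁ C F T h hk hi hj)
    obtain ⟨z, hz, hzr, hzl⟩ := O.exists_opposite C F hi hj hk
    have hez : ∀ o, e o ≠ z := by
      rintro (_ | l) rfl
      · rw [show e none = v from rfl, C.coord_self] at hz; norm_num at hz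
      · exact hz.ne (C.coord_other l)
    -- generators with a negative coordinate
    have hneg : ∀ b, τ (x b) < 0 → b = z := by
      intro b hb
      -- If only w l is outside the facet r, a negative `τ` must be compensated by a positive
      -- coordinate at l.
      have aux : ∀ (r : ι) (l : {i // f i (x v) = 0}), f r (x v) ≠ 0 → f l (x b) = 0 →
          ¬ ∀ m, m ≠ l → f r (x (w m)) = 0 := by
        intro r l hr hl hm
        have h1 := C.apply_eq (f r) (x b)
        rw [Finset.sum_eq_zero, add_zero] at h1
        · have := F.nonneg r b
          rw [h1] at this
          exact absurd this (not_le.2 (mul_neg_of_neg_of_pos hb (F.pos_of_ne hr)))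
        · intro m _
          by_cases hml : m = l
          · rw [hml, hl, zero_div, zero_mul]
          · rw [hm m hml, mul_zero]
      -- So b leaves the facets i, j and k, while z leaves no others.
      refine F.eq_of_zeros_subset fun r hr => ?_
      by_cases hrv : f r (x v) = 0
      · refine hzl ⟨r, hrv⟩ ?_ ?_ ?_
        · rintro h; exact aux r₁ i hv1 (h ▸ hr) u1
        · rintro h; exact aux r₂ j hv2 (h ▸ hr) u2
        · rintro h; exact aux r₃ k hv3 (h ▸ hr) u3
      · exact hzr r hrv
    let e' : Option {i // f i (x v) = 0} → {a // a ≠ z} := fun o => ⟨e o, hez o⟩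
    have he' : Function.Bijective e' := by
      refine ⟨fun o o' h => he (congrArg Subtype.val h), ?_⟩
      rintro ⟨a, ha⟩
      rcases C.eq_of_coord_nonneg F (not_lt.1 fun h => ha (hneg a h)) with rfl | ⟨i, rfl⟩
      exacts [⟨none, rfl⟩, ⟨some i, rfl⟩]
    have c1 := C.coord_eq (u := x z) hi (fun l hl => Or.inr (u1 l hl)) (hzr _ hv1)
    have c2 := C.coord_eq (u := x z) hj (fun l hl => Or.inr (u2 l hl)) (hzr _ hv2)
    have c3 := C.coord_eq (u := x z) hk (fun l hl => Or.inr (u3 l hl)) (hzr _ hv3)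
    have hτ : 0 < -τ (x z) := neg_pos.2 hz
    refine ⟨z, v, w i, w j, w k, ?_, (linearIndependent_equiv (Equiv.ofBijective e' he')).1 hli,
      ?_, -τ (x z), -τ (x z) * (f r₁ (x v) / f r₁ (x (w i))),
      -τ (x z) * (f r₂ (x v) / f r₂ (x (w j))), -τ (x z) * (f r₃ (x v) / f r₃ (x (w k))), hτ,
      mul_pos hτ (div_pos (F.pos_of_ne hv1) (F.pos_of_ne hi)),
      mul_pos hτ (div_pos (F.pos_of_ne hv2) (F.pos_of_ne hj)),
      mul_pos hτ (div_pos (F.pos_of_ne hv3) (F.pos_of_ne hk)), ?_⟩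
    · have n1 : ∀ l, z ≠ w l := fun l => (hez (some l)).symm
      have n2 : z ≠ v := (hez none).symm
      have n3 : ∀ l, v ≠ w l := fun l h => by simpa using he (a₁ := none) (a₂ := some l) h
      have n4 : ∀ l m, l ≠ m → w l ≠ w m := fun l m h h' => h (C.injective h')
      simp [n1, n2, n3, n4, hij, hik, hjk]
    · rw [← hcardJ, Fintype.card_of_bijective he', Fintype.card_subtype_compl,
        Fintype.card_subtype_eq]
      have : 0 < Fintype.card A := Fintype.card_pos
      omega
    · have h := C.expand (x z)
      rw [← Finset.sum_subset (Finset.subset_univ ({i, j, k} : Finset _)),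
        Finset.sum_insert (by simp [hij, hik]), Finset.sum_insert (by simp [hjk]),
        Finset.sum_singleton, c1, c2, c3] at h
      · linear_combination (norm := module) h
      · intro l _ hl
        simp only [mem_insert, mem_singleton, not_or] at hl
        rw [hzl l hl.1 hl.2.1 hl.2.2, zero_div, zero_smul]

end Cone

/-! ### Facet inequalities of a finitely generated pointed cone. -/

section FacetSets

variable {W A : Type*} [NormedAddCommGroup W] [NormedSpace ℝ W] [FiniteDimensional ℝ W]
  [Fintype A] {x : A → W}

/-- Positivity of `h` keeps 0 out of the compact hull of the generators, which can therefore be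
strictly separated from the ray through u. Separation gives only a weak sign at u; a small
perturbation makes it strict. -/
theorem exists_functional_of_not_inCone {h : W →ₗ[ℝ] ℝ} (hh : ∀ a, 0 < h (x a)) {u : W}
    (hu : ¬ InCone x u) : ∃ g : W →ₗ[ℝ] ℝ, (∀ a, 0 ≤ g (x a)) ∧ g u < 0 := by
  classical
  have hu0 : u ≠ 0 := by
    rintro rfl
    exact hu ⟨0, fun _ => le_rfl, by simp⟩
  let K : Set W := convexHull ℝ (Set.range x)
  have hray : Convex ℝ {p : W | ∃ t : ℝ, 0 ≤ t ∧ p = t • u} := by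
    rintro _ ⟨s, hs, rfl⟩ _ ⟨t, ht, rfl⟩ α β hα hβ -
    exact ⟨α * s + β * t, by positivity, by module⟩
  have hclosed : IsClosed {p : W | ∃ t : ℝ, 0 ≤ t ∧ p = t • u} := by
    have h1 : Topology.IsClosedEmbedding fun t : ℝ => t • u := isClosedEmbedding_smul_left hu0
    have h2 := h1.isClosedMap _ (isClosed_Ici (a := (0 : ℝ)))
    convert h2 using 1
    ext p
    simp [eq_comm]
  have hdisj : Disjoint K {p : W | ∃ t : ℝ, 0 ≤ t ∧ p = t • u} := by
    rw [Set.disjoint_left]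
    rintro p hp ⟨t, ht, rfl⟩
    simp only [K, convexHull_range_eq_exists_affineCombination] at hp
    obtain ⟨s, w, hw0, hw1, hp⟩ := hp
    rw [Finset.affineCombination_eq_linear_combination _ _ _ hw1] at hp
    have hpos : 0 < t := by
      refine lt_of_le_of_ne ht ?_
      rintro rfl
      rw [zero_smul] at hp
      have h1 := congrArg h hp
      simp only [map_sum, map_smul, smul_eq_mul, map_zero] at h1
      rw [Finset.sum_eq_zero_iff_of_nonneg fun a ha => mul_nonneg (hw0 a ha) (hh a).le] at h1
      have h2 : ∑ a ∈ s, w a = 0 := Finset.sum_eq_zero fun a ha =>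
        (mul_eq_zero.1 (h1 a ha)).resolve_right (hh a).ne'
      linarith
    refine hu ⟨fun a => if a ∈ s then t⁻¹ * w a else 0, fun a => ?_, ?_⟩
    · dsimp only
      split_ifs with ha
      · exact mul_nonneg (inv_nonneg.2 ht) (hw0 a ha)
      · exact le_rfl
    · simp only [ite_smul, zero_smul, Finset.sum_ite_mem, Finset.univ_inter, mul_smul]
      rw [← Finset.smul_sum, hp, smul_smul, inv_mul_cancel₀ hpos.ne', one_smul]
  obtain ⟨g, α, β, h1, h2, h3⟩ := geometric_hahn_banach_compact_closed
    (convex_convexHull ℝ _) ((Set.finite_range x).isCompact_convexHull ℝ) hray hclosed hdisj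
  have hβ : β < 0 := by simpa using h3 0 ⟨0, le_rfl, by simp⟩
  have hgu : 0 ≤ g u := by
    by_contra! hneg
    have := h3 ((β / g u) • u) ⟨_, (div_pos_of_neg_of_neg hβ hneg).le, rfl⟩
    rw [map_smul, smul_eq_mul, div_mul_cancel₀ _ hneg.ne] at this
    exact lt_irrefl _ this
  obtain ⟨k, hk⟩ : ∃ k : Module.Dual ℝ W, k u ≠ 0 := by
    by_contra! hk
    exact hu0 ((Module.forall_dual_apply_eq_zero_iff ℝ u).1 hk)
  obtain ⟨ε, hε, hpt⟩ := exists_pos_forall_add_mul_nonneg (fun a => -g (x a))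
    (fun a => -(k u * k (x a))) (fun a => by
      have := h1 (x a) (subset_convexHull ℝ _ ⟨a, rfl⟩)
      linarith) (fun a ha => by
      have := h1 (x a) (subset_convexHull ℝ _ ⟨a, rfl⟩)
      linarith)
  refine ⟨-(g : W →ₗ[ℝ] ℝ) - (ε * k u) • k, fun a => ?_, ?_⟩
  · have := hpt a
    simp only [LinearMap.sub_apply, LinearMap.neg_apply, LinearMap.smul_apply, smul_eq_mul,
      ContinuousLinearMap.coe_coe]
    linarith
  · simp only [LinearMap.sub_apply, LinearMap.neg_apply, LinearMap.smul_apply, smul_eq_mul,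
      ContinuousLinearMap.coe_coe]
    have : 0 < ε * (k u * k u) := mul_pos hε (mul_self_pos.2 hk)
    linarith

/-- `S` is the set of the generators on a facet of the cone generated by `x`. -/
def IsFacetSet (x : A → W) (S : Finset A) : Prop :=
  ∃ f : W →ₗ[ℝ] ℝ, (∀ a, 0 ≤ f (x a)) ∧ (∀ a, f (x a) = 0 ↔ a ∈ S) ∧
    finrank ℝ (Submodule.span ℝ (x '' S)) + 1 = finrank ℝ W

/-- While the zeros of `g` span less than a hyperplane, `g` is rotated about them, with its value at
u fixed, until it vanishes at a further generator. -/
theorem exists_facet_functional (hx : Submodule.span ℝ (Set.range x) = ⊤) {u : W}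
    (g : W →ₗ[ℝ] ℝ) (hg : ∀ a, 0 ≤ g (x a)) (hgu : g u < 0) :
    ∃ g : W →ₗ[ℝ] ℝ, (∀ a, 0 ≤ g (x a)) ∧ g u < 0 ∧
      finrank ℝ (Submodule.span ℝ (x '' {a | g (x a) = 0})) + 1 = finrank ℝ W := by
  induction hn : finrank ℝ W - finrank ℝ (Submodule.span ℝ (x '' {a | g (x a) = 0}))
    using Nat.strong_induction_on generalizing g with
  | _ n ih =>
  let Z (g : W →ₗ[ℝ] ℝ) := Submodule.span ℝ (x '' {a | g (x a) = 0})
  have hZ : ∀ g, Z g ≤ LinearMap.ker g := by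
    intro g
    rw [Submodule.span_le]
    rintro _ ⟨a, ha, rfl⟩
    exact ha
  have hlt : ∀ g : W →ₗ[ℝ] ℝ, g u < 0 → finrank ℝ (Z g) < finrank ℝ W := by
    intro g hgu
    refine Submodule.finrank_lt (lt_top_iff_ne_top.2 ?_).ne
    intro htop
    have : u ∈ LinearMap.ker g := hZ g (htop ▸ Submodule.mem_top)
    exact hgu.ne this
  have h1 := hlt g hgu
  by_cases hr : finrank ℝ (Z g) + 1 = finrank ℝ W
  · exact ⟨g, hg, hgu, hr⟩
  have hsup : Z g ⊔ Submodule.span ℝ {u} < ⊤ := by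
    refine lt_top_iff_ne_top.2 fun htop => ?_
    have h2 := Submodule.finrank_add_le_finrank_add_finrank (Z g) (Submodule.span ℝ {u})
    have h3 := finrank_span_singleton (K := ℝ) (v := u) (by rintro rfl; simp at hgu)
    rw [htop, finrank_top, h3] at h2
    omega
  obtain ⟨k, hk0, hk⟩ := Submodule.exists_le_ker_of_lt_top _ hsup
  have hkZ : ∀ a, g (x a) = 0 → k (x a) = 0 := fun a ha =>
    hk (Submodule.mem_sup_left (Submodule.subset_span ⟨a, ha, rfl⟩))
  have hku : k u = 0 := hk (Submodule.mem_sup_right (Submodule.mem_span_singleton_self u))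
  obtain ⟨k, ⟨a₀, ha₀⟩, hkZ, hku⟩ : ∃ k : W →ₗ[ℝ] ℝ, (∃ a, k (x a) < 0) ∧
      (∀ a, g (x a) = 0 → k (x a) = 0) ∧ k u = 0 := by
    by_cases hneg : ∃ a, k (x a) < 0
    · exact ⟨k, hneg, hkZ, hku⟩
    · refine ⟨-k, ?_, fun a ha => by simp [hkZ a ha], by simp [hku]⟩
      by_contra! hpos
      push Not at hneg
      refine hk0 (LinearMap.ext_on_range hx fun a => ?_)
      have := hpos a
      simp only [LinearMap.neg_apply, LinearMap.zero_apply] at this ⊢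
      linarith [hneg a]
  -- The minimal ratio is the largest t for which `g + t • k` is still nonnegative on the
  -- generators.
  obtain ⟨b, hb, hmin⟩ := Finset.exists_min_image ({a | k (x a) < 0} : Finset A)
    (fun a => g (x a) / -k (x a)) ⟨a₀, by simpa using ha₀⟩
  simp only [mem_filter_univ] at hb hmin
  set t := g (x b) / -k (x b) with ht
  have ht0 : 0 ≤ t := div_nonneg (hg b) (by linarith)
  have hval : ∀ v, (g + t • k) v = g v + t * k v := fun v => by simp
  have hgu' : (g + t • k) u < 0 := by rw [hval, hku]; simpa using hgu
  refine ih _ ?_ (g + t • k) (fun a => ?_) hgu' rfl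
  · rw [← hn]
    have hstrict : Z g < Z (g + t • k) := by
      refine lt_of_le_of_ne (Submodule.span_mono (Set.image_mono fun a ha => ?_)) fun heq => ?_
      · rw [Set.mem_ofPred_eq] at ha ⊢
        rw [hval, ha, hkZ a ha]; simp
      · have hbZ : x b ∈ Z (g + t • k) := Submodule.subset_span ⟨b, by
          rw [Set.mem_ofPred_eq, hval, ht, div_neg, neg_mul, div_mul_cancel₀ _ hb.ne,
            add_neg_cancel], rfl⟩
        rw [← heq] at hbZ
        have : Z g ≤ LinearMap.ker k := by
          rw [Submodule.span_le]
          rintro _ ⟨a, ha, rfl⟩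
          exact hkZ a ha
        exact hb.ne (this hbZ)
    have h2 := Submodule.finrank_lt_finrank_of_lt hstrict
    have h3 := hlt _ hgu'
    change finrank ℝ W - finrank ℝ (Z (g + t • k)) < finrank ℝ W - finrank ℝ (Z g)
    omega
  · rw [hval]
    rcases lt_or_ge (k (x a)) 0 with hka | hka
    · have := hmin a hka
      rw [le_div_iff₀ (by linarith)] at this
      linarith
    · exact add_nonneg (hg a) (mul_nonneg ht0 hka)

namespace IsFacetSet

/-- A functional defining the facet. -/
noncomputable def functional {S : Finset A} (hS : IsFacetSet x S) : W →ₗ[ℝ] ℝ := hS.choose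

omit [FiniteDimensional ℝ W] [Fintype A] in
theorem functional_nonneg {S : Finset A} (hS : IsFacetSet x S) (a : A) :
    0 ≤ hS.functional (x a) := hS.choose_spec.1 a

omit [FiniteDimensional ℝ W] [Fintype A] in
theorem functional_eq_zero {S : Finset A} (hS : IsFacetSet x S) {a : A} :
    hS.functional (x a) = 0 ↔ a ∈ S := hS.choose_spec.2.1 a

omit [FiniteDimensional ℝ W] [Fintype A] in
theorem finrank_span {S : Finset A} (hS : IsFacetSet x S) :
    finrank ℝ (Submodule.span ℝ (x '' S)) + 1 = finrank ℝ W := hS.choose_spec.2.2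

omit [FiniteDimensional ℝ W] [Fintype A] in
theorem exists_notMem (hx : Submodule.span ℝ (Set.range x) = ⊤) {S : Finset A}
    (hS : IsFacetSet x S) : ∃ b, b ∉ S := by
  by_contra! h
  have h1 : x '' S = Set.range x := by
    rw [← Set.image_univ]; congr 1; ext a; simp [h a]
  have := hS.finrank_span
  rw [h1, hx, finrank_top] at this
  omega

omit [Fintype A] in
theorem exists_eq_smul (hx : Submodule.span ℝ (Set.range x) = ⊤) {S : Finset A}
    (hS : IsFacetSet x S) {g : W →ₗ[ℝ] ℝ} (hg : ∀ a, 0 ≤ g (x a)) (hgS : ∀ a ∈ S, g (x a) = 0) :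
    ∃ t : ℝ, 0 ≤ t ∧ g = t • hS.functional := by
  obtain ⟨b, hb⟩ := hS.exists_notMem hx
  have hb0 : hS.functional (x b) ≠ 0 := fun h => hb (hS.functional_eq_zero.1 h)
  have hle : Submodule.span ℝ (x '' S) ≤ LinearMap.ker hS.functional := by
    rw [Submodule.span_le]
    rintro _ ⟨a, ha, rfl⟩
    exact hS.functional_eq_zero.2 ha
  have hlt : Submodule.span ℝ (x '' S) < Submodule.span ℝ (x '' S) ⊔ Submodule.span ℝ {x b} := by
    refine lt_of_le_of_ne le_sup_left fun heq => hb0 ?_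
    exact hle (heq ▸ Submodule.mem_sup_right (Submodule.mem_span_singleton_self _))
  have htop : Submodule.span ℝ (x '' S) ⊔ Submodule.span ℝ {x b} = ⊤ := by
    apply Submodule.eq_top_of_finrank_eq
    have h1 := Submodule.finrank_lt_finrank_of_lt hlt
    have h2 := hS.finrank_span
    have h3 := Submodule.finrank_le (Submodule.span ℝ (x '' S) ⊔ Submodule.span ℝ {x b})
    omega
  refine ⟨g (x b) / hS.functional (x b), div_nonneg (hg b) (hS.functional_nonneg b), ?_⟩
  have : ⊤ ≤ LinearMap.ker (g - (g (x b) / hS.functional (x b)) • hS.functional) := by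
    rw [← htop, sup_le_iff, Submodule.span_le, Submodule.span_le]
    constructor
    · rintro _ ⟨a, ha, rfl⟩
      simp [hgS a ha, hS.functional_eq_zero.2 ha]
    · rintro _ rfl
      simp [hb0]
  exact sub_eq_zero.1 (LinearMap.ker_eq_top.1 (top_le_iff.1 this))

end IsFacetSet

/-- The facets of a pointed polyhedral cone form a facet system. -/
theorem facetSystem (hx : Submodule.span ℝ (Set.range x) = ⊤) {h : W →ₗ[ℝ] ℝ}
    (hh : ∀ a, 0 < h (x a)) (hind : ∀ a (c : A → ℝ), (∀ b, 0 ≤ c b) → c a = 0 →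
      ∑ b, c b • x b ≠ x a) :
    FacetSystem x fun S : {S // IsFacetSet x S} => S.2.functional := by
  classical
  have hmem : ∀ u, (∀ S : {S // IsFacetSet x S}, 0 ≤ S.2.functional u) → InCone x u := by
    intro u hu
    by_contra hcon
    obtain ⟨g₀, hg₀, hg₀u⟩ := exists_functional_of_not_inCone hh hcon
    obtain ⟨g, hg, hgu, hrank⟩ := exists_facet_functional hx g₀ hg₀ hg₀u
    have hS : IsFacetSet x ({a | g (x a) = 0} : Finset A) :=
      ⟨g, hg, by simp, by rw [← hrank, Finset.coe_filter_univ]⟩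
    obtain ⟨t, ht, hgt⟩ := hS.exists_eq_smul hx hg (by simp)
    have h1 : g u = t * hS.functional u := by conv_lhs => rw [hgt]; simp
    have := mul_nonneg ht (hu ⟨_, hS⟩)
    linarith
  have hext : ∀ a u, (∀ S : {S // IsFacetSet x S}, S.2.functional (x a) = 0 →
      S.2.functional u = 0) → ∃ t : ℝ, u = t • x a := by
    intro a u hu
    have key : ∀ v, (∀ S : {S // IsFacetSet x S}, S.2.functional (x a) = 0 →
        S.2.functional v = 0) → ∃ ε : ℝ, 0 < ε ∧ InCone x (x a + ε • v) := by
      intro v hv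
      obtain ⟨ε, hε, hpt⟩ := exists_pos_forall_add_mul_nonneg
        (fun S : {S // IsFacetSet x S} => S.2.functional (x a)) (fun S => S.2.functional v)
        (fun S => S.2.functional_nonneg a) (fun S hS => (hv S hS).ge)
      exact ⟨ε, hε, hmem _ fun S => by simpa using hpt S⟩
    obtain ⟨ε, hε, c, hc, hcu⟩ := key u hu
    obtain ⟨δ, hδ, e, he, heu⟩ := key (-u) fun S hS => by simp [hu S hS]
    have hsum : ∑ b, (δ * c b + ε * e b) • x b = (δ + ε) • x a := by
      simp only [add_smul, mul_smul, Finset.sum_add_distrib, ← Finset.smul_sum, hcu, heu]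
      module
    have hnn : ∀ b, 0 ≤ δ * c b + ε * e b := fun b =>
      add_nonneg (mul_nonneg hδ.le (hc b)) (mul_nonneg hε.le (he b))
    have hsplit : ∑ b ∈ univ.erase a, (δ * c b + ε * e b) • x b =
        (δ + ε - (δ * c a + ε * e a)) • x a := by
      rw [sub_smul, ← hsum, ← Finset.add_sum_erase _ _ (mem_univ a), add_sub_cancel_left]
    -- A positive factor would make `x a` a nonnegative combination of the other generators.
    -- Otherwise `h` shows that all other terms vanish.
    rcases lt_or_ge 0 (δ + ε - (δ * c a + ε * e a)) with hpos | hneg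
    · exfalso
      set s := δ + ε - (δ * c a + ε * e a)
      refine hind a (fun b => if b = a then 0 else s⁻¹ * (δ * c b + ε * e b)) (fun b => ?_)
        (by simp) ?_
      · split_ifs
        exacts [le_rfl, mul_nonneg (inv_nonneg.2 hpos.le) (hnn b)]
      · rw [← Finset.add_sum_erase _ _ (mem_univ a)]
        rw [Finset.sum_congr rfl fun b hb => by rw [if_neg (Finset.ne_of_mem_erase hb), mul_smul],
          ← Finset.smul_sum, hsplit, smul_smul, inv_mul_cancel₀ hpos.ne']
        simp
    · have h1 := congrArg h hsplit
      simp only [map_sum, map_smul, smul_eq_mul] at h1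
      have h2 : ∀ b ∈ univ.erase a, 0 ≤ (δ * c b + ε * e b) * h (x b) := fun b _ =>
        mul_nonneg (hnn b) (hh b).le
      have h3 : ∑ b ∈ univ.erase a, (δ * c b + ε * e b) * h (x b) = 0 :=
        le_antisymm (h1 ▸ mul_nonpos_of_nonpos_of_nonneg hneg (hh a).le) (Finset.sum_nonneg h2)
      rw [Finset.sum_eq_zero_iff_of_nonneg h2] at h3
      have h4 : ∀ b, b ≠ a → c b = 0 := by
        intro b hb
        have h5 := (mul_eq_zero.1 (h3 b (by simp [hb]))).resolve_right (hh b).ne'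
        have h6 := mul_nonneg hδ.le (hc b)
        have h7 := mul_nonneg hε.le (he b)
        exact (mul_eq_zero.1 (by linarith : δ * c b = 0)).resolve_left hδ.ne'
      rw [Finset.sum_eq_single a (fun b _ hb => by rw [h4 b hb, zero_smul]) (by simp)] at hcu
      refine ⟨ε⁻¹ * (c a - 1), ?_⟩
      have h8 : ε • u = (c a - 1) • x a := by rw [sub_smul, hcu]; module
      rw [mul_smul, ← h8, smul_smul, inv_mul_cancel₀ hε.ne', one_smul]
  refine ⟨fun S a => S.2.functional_nonneg a, hmem, ?_, hext, ?_, ?_⟩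
  · rintro ⟨S, hS⟩ ⟨S', hS'⟩ hne
    by_contra! hcon
    have hsub : ∀ a ∈ S, hS'.functional (x a) = 0 := fun a ha =>
      le_antisymm (hcon a (hS.functional_eq_zero.2 ha)) (hS'.functional_nonneg a)
    obtain ⟨t, ht, h1⟩ := hS.exists_eq_smul hx hS'.functional_nonneg hsub
    have ht0 : t ≠ 0 := by
      rintro rfl
      obtain ⟨b, hb⟩ := hS'.exists_notMem hx
      exact hb (hS'.functional_eq_zero.1 (by rw [h1]; simp))
    refine hne (Subtype.ext (Finset.ext fun a => ?_))
    simp only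
    rw [← hS.functional_eq_zero, ← hS'.functional_eq_zero, h1]
    simp [ht0]
  · intro a
    by_contra! hcon
    obtain ⟨c, hc, hsum⟩ := hmem (-x a) fun S => by
      rw [map_neg]
      exact neg_nonneg.2 (hcon S)
    have h1 := congrArg h hsum
    simp only [map_sum, map_smul, smul_eq_mul, map_neg] at h1
    have h2 : 0 ≤ ∑ b, c b * h (x b) := Finset.sum_nonneg fun b _ => mul_nonneg (hc b) (hh b).le
    linarith [hh a]
  · intro a b t hab
    by_contra hne
    have ht : 0 ≤ t := by
      have h1 := hh b
      rw [hab, map_smul, smul_eq_mul] at h1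
      exact (pos_of_mul_pos_left h1 (hh a).le).le
    refine hind b (Pi.single a t) (fun c => ?_)
      (Pi.single_eq_of_ne (M := fun _ => ℝ) (Ne.symm hne) t) ?_
    · rw [Pi.single_apply]; split_ifs; exacts [ht, le_rfl]
    · rw [Finset.sum_eq_single a (fun c _ hc => by rw [Pi.single_eq_of_ne hc, zero_smul])
        (by simp), Pi.single_eq_same, hab]

end FacetSets

/-! ### Faces of a polytope in terms of its vertices. -/

section Faces

variable {E : Type*} [NormedAddCommGroup E] [NormedSpace ℝ E]

theorem IsPolytope.finite_vertices {d : ℕ} {P : Set E} (hP : IsPolytope d P) :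
    (vertices P).Finite := by
  obtain ⟨s, rfl⟩ := hP.exists_finset
  exact s.finite_toSet.subset extremePoints_convexHull_subset

theorem IsPolytope.convexHull_vertices {d : ℕ} {P : Set E} (hP : IsPolytope d P) :
    convexHull ℝ (vertices P) = P := by
  have h1 := (hP.finite_vertices.isClosed_convexHull ℝ).closure_eq
  obtain ⟨s, rfl⟩ := hP.exists_finset
  rw [← h1]
  exact closure_convexHull_extremePoints (s.finite_toSet.isCompact_convexHull ℝ)
    (convex_convexHull ℝ _)

theorem IsPolytope.nonempty_vertices {d : ℕ} {P : Set E} (hP : IsPolytope d P) :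
    (vertices P).Nonempty := by
  rw [← convexHull_nonempty_iff (𝕜 := ℝ), hP.convexHull_vertices]
  exact hP.nonempty

/-- The face of the convex hull of `V` where the functional `l` attains its lower bound `c`. -/
theorem convexHull_inter_eq_convexHull {V : Set E} (hV : V.Finite) {l : E →ₗ[ℝ] ℝ} {c : ℝ}
    (hl : ∀ p ∈ V, c ≤ l p) :
    {p ∈ convexHull ℝ V | l p = c} = convexHull ℝ {p ∈ V | l p = c} := by
  classical
  apply subset_antisymm
  · rintro p ⟨hp, hpc⟩
    lift V to Finset E using hV
    rw [Finset.mem_convexHull'] at hp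
    obtain ⟨w, hw0, hw1, rfl⟩ := hp
    have h0 : ∑ y ∈ V, w y * (l y - c) = 0 := by
      simp only [mul_sub, Finset.sum_sub_distrib, ← Finset.sum_mul, hw1]
      simp only [map_sum, map_smul, smul_eq_mul] at hpc
      linarith
    rw [Finset.sum_eq_zero_iff_of_nonneg fun y hy =>
      mul_nonneg (hw0 y hy) (sub_nonneg.2 (hl y hy))] at h0
    have hw : ∀ y ∈ V, l y ≠ c → w y = 0 := fun y hy hyc =>
      (mul_eq_zero.1 (h0 y hy)).resolve_right (sub_ne_zero.2 hyc)
    have e1 : ∑ y ∈ V with l y = c, w y = 1 := by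
      rw [← hw1]
      refine Finset.sum_subset (Finset.filter_subset _ _) fun y hy hy' => hw y hy fun h => ?_
      exact hy' (Finset.mem_filter.2 ⟨hy, h⟩)
    have e2 : ∑ y ∈ V with l y = c, w y • y = ∑ y ∈ V, w y • y := by
      refine Finset.sum_subset (Finset.filter_subset _ _) fun y hy hy' => ?_
      rw [hw y hy fun h => hy' (Finset.mem_filter.2 ⟨hy, h⟩), zero_smul]
    rw [← e2]
    refine (convex_convexHull ℝ _).sum_mem (fun y hy => hw0 y (Finset.mem_filter.1 hy).1) e1
      fun y hy => subset_convexHull ℝ _ ?_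
    simpa using Finset.mem_filter.1 hy
  · refine convexHull_min (fun p hp => ⟨subset_convexHull ℝ _ hp.1, hp.2⟩) ?_
    exact (convex_convexHull ℝ _).inter (convex_hyperplane l.isLinear c)

theorem le_of_mem_convexHull {V : Set E} {l : E →ₗ[ℝ] ℝ} {c : ℝ} (hl : ∀ p ∈ V, c ≤ l p) {p : E}
    (hp : p ∈ convexHull ℝ V) : c ≤ l p :=
  convexHull_min (t := {p | c ≤ l p}) hl (convex_halfSpace_ge l.isLinear c) hp

theorem isExposed_of_le [FiniteDimensional ℝ E] {P : Set E} {l : E →ₗ[ℝ] ℝ} {c : ℝ}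
    (hl : ∀ p ∈ P, c ≤ l p) : IsExposed ℝ P {p ∈ P | l p = c} := by
  rintro ⟨q, hq, hqc⟩
  refine ⟨-(LinearMap.toContinuousLinearMap l), ?_⟩
  ext p
  simp only [neg_apply, LinearMap.coe_toContinuousLinearMap', neg_le_neg_iff]
  constructor
  · rintro ⟨hp, hpc⟩
    exact ⟨hp, fun y hy => hpc ▸ hl y hy⟩
  · rintro ⟨hp, hpy⟩
    exact ⟨hp, le_antisymm (hqc ▸ hpy q hq) (hl p hp)⟩

theorem finrank_vectorSpan_convexHull (V : Set E) :
    finrank ℝ (vectorSpan ℝ (convexHull ℝ V)) = finrank ℝ (vectorSpan ℝ V) := by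
  rw [← direction_affineSpan, affineSpan_convexHull, direction_affineSpan]

/-- The dimension of the linear span of the homogenization of a set. -/
theorem finrank_span_homogenization [FiniteDimensional ℝ E] {V : Set E} (hV : V.Nonempty) :
    finrank ℝ (Submodule.span ℝ ((fun p => (p, (1 : ℝ))) '' V)) =
      finrank ℝ (vectorSpan ℝ V) + 1 := by
  obtain ⟨p₀, hp₀⟩ := hV
  let φ : (vectorSpan ℝ V × ℝ) →ₗ[ℝ] E × ℝ :=
    LinearMap.prod ((vectorSpan ℝ V).subtype ∘ₗ LinearMap.fst ℝ _ _ +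
      (LinearMap.toSpanSingleton ℝ E p₀) ∘ₗ LinearMap.snd ℝ _ _) (LinearMap.snd ℝ _ _)
  have hφ : ∀ v t, φ (v, t) = ((v : E) + t • p₀, t) := fun v t => by simp [φ]
  have hinj : Function.Injective φ := by
    rw [injective_iff_map_eq_zero]
    rintro ⟨v, t⟩ h
    rw [hφ, Prod.mk_eq_zero] at h
    obtain ⟨h1, rfl⟩ := h
    rw [zero_smul, add_zero] at h1
    exact Prod.ext (Subtype.ext h1) rfl
  have hrange : LinearMap.range φ = Submodule.span ℝ ((fun p => (p, (1 : ℝ))) '' V) := by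
    apply le_antisymm
    · rintro _ ⟨⟨⟨v, hv⟩, t⟩, rfl⟩
      rw [hφ]
      have hp : (p₀, (1 : ℝ)) ∈ Submodule.span ℝ ((fun p => (p, (1 : ℝ))) '' V) :=
        Submodule.subset_span ⟨p₀, hp₀, rfl⟩
      have h1 : vectorSpan ℝ V ≤ (Submodule.span ℝ ((fun p => (p, (1 : ℝ))) '' V)).comap
          (LinearMap.inl ℝ E ℝ) := by
        rw [vectorSpan_eq_span_vsub_set_right ℝ hp₀, Submodule.span_le]
        rintro _ ⟨p, hp', rfl⟩
        have := Submodule.sub_mem _ (Submodule.subset_span (R := ℝ)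
          (Set.mem_image_of_mem (fun p => (p, (1 : ℝ))) hp')) hp
        simpa using this
      have h2 := Submodule.add_mem _ (Submodule.mem_comap.1 (h1 hv)) (Submodule.smul_mem _ t hp)
      simpa using h2
    · rw [Submodule.span_le]
      rintro _ ⟨p, hp, rfl⟩
      exact ⟨(⟨p -ᵥ p₀, vsub_mem_vectorSpan ℝ hp hp₀⟩, 1), by simp [hφ]⟩
  rw [← hrange, LinearMap.finrank_range_of_inj hinj, finrank_prod, finrank_self]

theorem not_wbtw_of_vertices {P : Set E} {a b c : E} (ha : a ∈ vertices P)
    (hb : b ∈ vertices P) (hc : c ∈ vertices P) (hab : a ≠ b) (hbc : b ≠ c) : ¬ Wbtw ℝ a b c := by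
  rw [← mem_segment_iff_wbtw]
  intro h
  exact hab (hb.2 ha.1 hc.1 (mem_openSegment_of_ne_left_right hab hbc.symm h))

theorem affineIndependent_of_vertices {P : Set E} {a b c : E} (ha : a ∈ vertices P)
    (hb : b ∈ vertices P) (hc : c ∈ vertices P) (hab : a ≠ b) (hac : a ≠ c) (hbc : b ≠ c) :
    AffineIndependent ℝ ![a, b, c] := by
  rw [affineIndependent_iff_not_collinear_set]
  intro h
  rcases h.wbtw_or_wbtw_or_wbtw with h | h | h
  · exact not_wbtw_of_vertices ha hb hc hab hbc h
  · exact not_wbtw_of_vertices hb hc ha hbc hac.symm h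
  · exact not_wbtw_of_vertices hc ha hb hac.symm hab h

/-- A face of a polytope spanned by at least four vertices is not contained in a plane, if the
polytope is 2-simplicial. -/
theorem IsSimplicial.false_of_four_vertices [FiniteDimensional ℝ E] {d : ℕ} {P : Set E}
    (hP : IsPolytope d P) (hS : IsSimplicial 2 P) {l : E →ₗ[ℝ] ℝ} {c : ℝ}
    (hl : ∀ p ∈ vertices P, c ≤ l p)
    (hrank : finrank ℝ (vectorSpan ℝ {p ∈ vertices P | l p = c}) ≤ 2) {p q r s : E}
    (hp : p ∈ vertices P) (hq : q ∈ vertices P) (hr : r ∈ vertices P) (hs : s ∈ vertices P)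
    (hpl : l p = c) (hql : l q = c) (hrl : l r = c) (hsl : l s = c)
    (hnodup : [p, q, r, s].Nodup) : False := by
  classical
  have hface := convexHull_inter_eq_convexHull hP.finite_vertices hl
  have hexp : IsExposed ℝ P {x ∈ P | l x = c} := isExposed_of_le fun x hx => by
    rw [← hP.convexHull_vertices] at hx
    exact le_of_mem_convexHull hl hx
  rw [hP.convexHull_vertices] at hface
  have hpqr : AffineIndependent ℝ ![p, q, r] := by
    simp only [List.nodup_cons, List.mem_cons, List.not_mem_nil, or_false, not_or] at hnodup
    exact affineIndependent_of_vertices hp hq hr hnodup.1.1 hnodup.1.2.1 hnodup.2.1.1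
  have h2 : finrank ℝ (vectorSpan ℝ {x ∈ vertices P | l x = c}) = 2 := by
    refine le_antisymm hrank ?_
    rw [← hpqr.finrank_vectorSpan (n := 2) (by simp)]
    refine Submodule.finrank_mono (vectorSpan_mono ℝ ?_)
    rintro _ ⟨i, rfl⟩
    fin_cases i
    exacts [⟨hp, hpl⟩, ⟨hq, hql⟩, ⟨hr, hrl⟩]
  obtain ⟨t, ht, -, hst⟩ := hS {x ∈ P | l x = c} ⟨⟨p, hp.1, hpl⟩, hexp, by
    rw [hface, finrank_vectorSpan_convexHull, h2]⟩
  have hmem : ∀ y, y ∈ vertices P → l y = c → y ∈ t := by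
    intro y hy hyl
    have : y ∈ Set.extremePoints ℝ {x ∈ P | l x = c} :=
      inter_extremePoints_subset_extremePoints_of_subset (Set.sep_subset _ _) ⟨⟨hy.1, hyl⟩, hy⟩
    rw [hst] at this
    exact extremePoints_convexHull_subset this
  have h4 : [p, q, r, s].toFinset ⊆ t := by
    intro y hy
    simp only [List.mem_toFinset, List.mem_cons, List.not_mem_nil, or_false] at hy
    rcases hy with rfl | rfl | rfl | rfl
    exacts [hmem _ hp hpl, hmem _ hq hql, hmem _ hr hrl, hmem _ hs hsl]
  have := Finset.card_le_card h4
  rw [List.toFinset_card_of_nodup hnodup, ht] at this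
  simp at this

end Faces

theorem finrank_span_image_of_injective {V W A : Type*} [AddCommGroup V] [Module ℝ V]
    [AddCommGroup W] [Module ℝ W] {f : V →ₗ[ℝ] W} (hf : Function.Injective f) (x : A → V)
    (S : Set A) : finrank ℝ (Submodule.span ℝ ((fun a => f (x a)) '' S)) =
      finrank ℝ (Submodule.span ℝ (x '' S)) := by
  rw [← Set.image_image f x, ← Submodule.map_span]
  exact (Submodule.equivMapOfInjective f hf _).finrank_eq.symm

/-! ### The cone over a 2-simplicial polytope. -/

section Homogenization

variable {E : Type*} [NormedAddCommGroup E] [NormedSpace ℝ E] {d : ℕ} {P : Set E}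

theorem IsPolytope.convex (hP : IsPolytope d P) : Convex ℝ P := by
  rw [← hP.convexHull_vertices]
  exact convex_convexHull ℝ _

theorem mem_facets_of_le [FiniteDimensional ℝ E] (hP : IsPolytope d P) {l : E →ₗ[ℝ] ℝ} {c : ℝ}
    (hl : ∀ p ∈ vertices P, c ≤ l p) (hne : {p ∈ vertices P | l p = c}.Nonempty)
    (hrank : finrank ℝ (vectorSpan ℝ {p ∈ vertices P | l p = c}) + 1 = d) :
    {p ∈ P | l p = c} ∈ facets P := by
  refine ⟨_, ⟨?_, isExposed_of_le fun x hx => ?_, rfl⟩, ?_⟩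
  · obtain ⟨p, hp, hpc⟩ := hne
    exact ⟨p, hp.1, hpc⟩
  · rw [← hP.convexHull_vertices] at hx
    exact le_of_mem_convexHull hl hx
  · have := convexHull_inter_eq_convexHull hP.finite_vertices hl
    rw [hP.convexHull_vertices] at this
    rw [this, finrank_vectorSpan_convexHull, hrank, hP.finrank_eq]

/-- The linear span of the homogenization `P × {1}` of `P`. -/
abbrev HomogenizationSpan (P : Set E) : Submodule ℝ (E × ℝ) :=
  Submodule.span ℝ ((fun p => (p, (1 : ℝ))) '' vertices P)

/-- The vertices of the homogenization `P × {1}` of `P`. -/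
def homogenization (P : Set E) (a : vertices P) : HomogenizationSpan P :=
  ⟨((a : E), 1), Submodule.subset_span ⟨a, a.2, rfl⟩⟩

theorem coe_homogenization (a : vertices P) :
    (homogenization P a : E × ℝ) = ((a : E), 1) := rfl

theorem span_range_homogenization : Submodule.span ℝ (Set.range (homogenization P)) = ⊤ := by
  apply Submodule.map_injective_of_injective (HomogenizationSpan P).subtype_injective
  rw [Submodule.map_span, Submodule.map_subtype_top, ← Set.range_comp]
  congr 1
  ext q
  simp [homogenization]

/-- This turns supporting functionals of the cone into affine functions supporting P. -/
theorem exists_affine_of_functional (g : HomogenizationSpan P →ₗ[ℝ] ℝ) :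
    ∃ (l : E →ₗ[ℝ] ℝ) (c : ℝ), ∀ a, g (homogenization P a) = l a - c := by
  obtain ⟨k, hk⟩ := LinearMap.exists_extend g
  refine ⟨k ∘ₗ LinearMap.inl ℝ E ℝ, -k (0, 1), fun a => ?_⟩
  rw [← hk, LinearMap.comp_apply, Submodule.subtype_apply, coe_homogenization, sub_neg_eq_add,
    LinearMap.comp_apply, ← map_add]
  simp

theorem finrank_span_homogenization_image [FiniteDimensional ℝ E] {S : Set (vertices P)}
    (hS : S.Nonempty) : finrank ℝ (Submodule.span ℝ (homogenization P '' S)) =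
      finrank ℝ (vectorSpan ℝ ((↑) '' S : Set E)) + 1 := by
  rw [← finrank_span_homogenization (hS.image _),
    ← finrank_span_image_of_injective (HomogenizationSpan P).subtype_injective, Set.image_image]
  rfl

theorem finrank_homogenizationSpan [FiniteDimensional ℝ E] (hP : IsPolytope d P) :
    finrank ℝ (HomogenizationSpan P) = d + 1 := by
  rw [finrank_span_homogenization hP.nonempty_vertices, ← finrank_vectorSpan_convexHull,
    hP.convexHull_vertices, hP.finrank_eq]

/-- The last coordinate forces the coefficients to sum to 1, so equality would write a vertex as a
convex combination of others. -/
theorem homogenization_independent [Fintype (vertices P)] (hex : Convex ℝ P)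
    (a : vertices P) (c : vertices P → ℝ)
    (hc : ∀ b, 0 ≤ c b) (hca : c a = 0) :
    ∑ b, c b • homogenization P b ≠ homogenization P a := by
  classical
  intro h
  have h1 := congrArg (fun q : HomogenizationSpan P => (q : E × ℝ)) h
  simp only [AddSubmonoidClass.coe_finsetSum, SetLike.val_smul, coe_homogenization] at h1
  have e1 : ∑ b, c b • (b : E) = a := by
    have := congrArg Prod.fst h1
    simpa [Prod.fst_sum] using this
  have e2 : ∑ b, c b = 1 := by
    have := congrArg Prod.snd h1
    simpa [Prod.snd_sum] using this
  have := (hex.mem_extremePoints_iff_mem_sdiff_convexHull_sdiff.1 a.2).2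
  refine this ?_
  rw [← Finset.sum_erase univ (a := a) (by rw [hca, zero_smul])] at e1
  suffices h : ∑ b ∈ univ.erase a, c b • (b : E) ∈ convexHull ℝ (P \ {(a : E)}) by rwa [e1] at h
  refine (convex_convexHull ℝ _).sum_mem (fun b _ => hc b) ?_ fun b hb => ?_
  · rw [Finset.sum_erase univ hca, e2]
  · refine subset_convexHull ℝ _ ⟨b.2.1, fun hb' => ?_⟩
    exact Finset.ne_of_mem_erase hb (Subtype.ext hb')

theorem facesTriangular_homogenization [FiniteDimensional ℝ E] [Fintype (vertices P)]
    (hP : IsPolytope d P) (hS : IsSimplicial 2 P) {ι : Type*} [Finite ι]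
    {f : ι → HomogenizationSpan P →ₗ[ℝ] ℝ} (hf : ∀ i a, 0 ≤ f i (homogenization P a)) :
    FacesTriangular (homogenization P) f := by
  classical
  intro S e₁ e₂ e₃ he p q r s hnodup hp hq hr hs
  have hfin := Fintype.ofFinite ι
  -- The sum vanishes exactly where all `f i` with i in S do, so the face is exposed by one
  -- functional.
  obtain ⟨l, c, hlc⟩ := exists_affine_of_functional (∑ i with i ∈ S, f i)
  have hzero : ∀ a : vertices P, l a = c ↔ ∀ i ∈ S, f i (homogenization P a) = 0 := by
    intro a
    rw [← sub_eq_zero, ← hlc, LinearMap.sum_apply,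
      Finset.sum_eq_zero_iff_of_nonneg fun i _ => hf i a]
    simp
  have hle : ∀ p ∈ vertices P, c ≤ l p := by
    intro p hp
    have h1 := hlc ⟨p, hp⟩
    rw [LinearMap.sum_apply] at h1
    exact sub_nonneg.1 (h1 ▸ Finset.sum_nonneg fun i _ => hf i _)
  refine hS.false_of_four_vertices hP hle ?_ p.2 q.2 r.2 s.2 ((hzero p).2 hp) ((hzero q).2 hq)
    ((hzero r).2 hr) ((hzero s).2 hs) (hnodup.map Subtype.val_injective)
  have himage : {p ∈ vertices P | l p = c} = (↑) '' {a : vertices P | l a = c} := by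
    ext p; simp [and_comm]
  have h1 := finrank_span_homogenization_image (P := P) (S := {a : vertices P | l a = c})
    ⟨p, (hzero p).2 hp⟩
  have h2 : finrank ℝ (Submodule.span ℝ (homogenization P '' {a : vertices P | l a = c})) ≤ 3 := by
    have h3 : Submodule.span ℝ (homogenization P '' {a : vertices P | l a = c}) ≤
        Submodule.span ℝ (({e₁, e₂, e₃} : Finset _) : Set (HomogenizationSpan P)) := by
      rw [Submodule.span_le]
      rintro _ ⟨a, ha, rfl⟩
      obtain ⟨t₁, t₂, t₃, h⟩ := he a ((hzero a).1 ha)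
      rw [h]
      refine Submodule.add_mem _ (Submodule.add_mem _ ?_ ?_) ?_ <;>
        exact Submodule.smul_mem _ _ (Submodule.subset_span (by simp))
    exact (Submodule.finrank_mono h3).trans
      ((finrank_span_finset_le_card _).trans Finset.card_le_three)
  rw [himage]
  omega

/-- The facets of the homogenization of a polytope come from facets of the polytope. -/
theorem card_facetSets_le [FiniteDimensional ℝ E] [Fintype (vertices P)] (hP : IsPolytope d P)
    (hd : 1 ≤ d) :
    ENat.card {S : Finset (vertices P) // IsFacetSet (homogenization P) S} ≤
      (facets P).encard := by
  choose l c hlc using fun S : {S : Finset (vertices P) // IsFacetSet (homogenization P) S} =>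
    exists_affine_of_functional S.2.functional
  have hzero : ∀ (S : {S : Finset (vertices P) // IsFacetSet (homogenization P) S})
      (a : vertices P), l S a = c S ↔ a ∈ S.1 := by
    intro S a
    rw [← sub_eq_zero, ← hlc, S.2.functional_eq_zero]
  have hle : ∀ S, ∀ p ∈ vertices P, c S ≤ l S p := fun S p hp =>
    sub_nonneg.1 (hlc S ⟨p, hp⟩ ▸ S.2.functional_nonneg _)
  let Φ : {S : Finset (vertices P) // IsFacetSet (homogenization P) S} → Set E :=
    fun S => {p ∈ P | l S p = c S}
  have hinj : Function.Injective Φ := by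
    intro S S' h
    refine Subtype.ext (Finset.ext fun a => ?_)
    have := Set.ext_iff.1 h a
    simp only [Φ, Set.mem_sep_iff, a.2.1, true_and] at this
    rw [← hzero, this, hzero]
  refine hinj.encard_range.trans (Set.encard_le_encard ?_)
  rintro _ ⟨S, rfl⟩
  have himage : {p ∈ vertices P | l S p = c S} = (↑) '' (S.1 : Set (vertices P)) := by
    ext p
    constructor
    · rintro ⟨hp, hpc⟩
      exact ⟨⟨p, hp⟩, (hzero S ⟨p, hp⟩).1 hpc, rfl⟩
    · rintro ⟨a, ha, rfl⟩
      exact ⟨a.2, (hzero S a).2 ha⟩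
  have hrank := S.2.finrank_span
  rw [finrank_homogenizationSpan hP] at hrank
  have hne : (S.1 : Set (vertices P)).Nonempty := by
    rw [Set.nonempty_iff_ne_empty]
    intro h
    rw [h, Set.image_empty, Submodule.span_empty, finrank_bot] at hrank
    omega
  rw [finrank_span_homogenization_image hne] at hrank
  refine mem_facets_of_le hP (hle S) ?_ ?_
  · rw [himage]; exact hne.image _
  · rw [himage]; omega

theorem IsSimplicial.isBasisOrBipyramidal [FiniteDimensional ℝ E] [Fintype (vertices P)]
    (hP : IsPolytope d P) (hd : 2 ≤ d) (hS : IsSimplicial 2 P)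
    (hcard : (facets P).encard ≤ (d : ℕ∞) + 3) : IsBasisOrBipyramidal (homogenization P) := by
  classical
  have hfin := Fintype.ofFinite {S : Finset (vertices P) // IsFacetSet (homogenization P) S}
  have hne : Nonempty (vertices P) := hP.nonempty_vertices.to_subtype
  have hrank := finrank_homogenizationSpan hP
  have F := facetSystem span_range_homogenization
    (h := LinearMap.snd ℝ E ℝ ∘ₗ (HomogenizationSpan P).subtype)
    (by simp [coe_homogenization]) (homogenization_independent hP.convex)
  refine F.isBasisOrBipyramidal (facesTriangular_homogenization hP hS F.nonneg) (by omega) ?_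
  have h1 := (card_facetSets_le hP (by omega)).trans hcard
  rw [ENat.card_eq_coe_fintype_card] at h1
  have h2 : Fintype.card {S : Finset (vertices P) // IsFacetSet (homogenization P) S} ≤ d + 3 := by
    exact_mod_cast h1
  omega

end Homogenization

/-! ### From linear relations back to simplices, bipyramids and pyramids. -/

section Bipyramid

variable {E : Type*} [NormedAddCommGroup E] [NormedSpace ℝ E] {d : ℕ} {P : Set E}

theorem notMem_affineSpan_of_functional {V : Set E} {l : E →ₗ[ℝ] ℝ} {c : ℝ}
    (hl : ∀ p ∈ V, l p = c) {q : E} (hq : l q ≠ c) : q ∉ affineSpan ℝ V := by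
  intro h
  have h1 := AffineSubspace.mem_map_of_mem l.toAffineMap h
  rw [AffineSubspace.map_span] at h1
  have h2 : l.toAffineMap '' V ⊆ {c} := by
    rintro _ ⟨p, hp, rfl⟩
    exact hl p hp
  exact hq ((AffineSubspace.mem_affineSpan_singleton ℝ ℝ).1 (affineSpan_mono ℝ h2 h1))

/-- Positive convex combinations of affinely independent points are in the relative interior of
their convex hull. -/
theorem mem_intrinsicInterior_convexHull [FiniteDimensional ℝ E] {ι : Type*} [Fintype ι]
    [DecidableEq ι] {p : ι → E} {l : ι → E →ₗ[ℝ] ℝ} {c : ι → ℝ}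
    (hl : ∀ i j, l i (p j) = c i + if i = j then 1 else 0) {w : ι → ℝ} (hw : ∀ i, 0 < w i)
    (hw1 : ∑ i, w i = 1) :
    ∑ i, w i • p i ∈ intrinsicInterior ℝ (convexHull ℝ (Set.range p)) := by
  have hcomb : ∀ v : ι → ℝ, ∑ j, v j = 1 → ∀ i, l i (∑ j, v j • p j) = c i + v i := by
    intro v hv i
    simp [hl, mul_add, Finset.sum_add_distrib, ← Finset.sum_mul, hv]
  have hmem : ∀ v : ι → ℝ, (∀ i, 0 ≤ v i) → ∑ j, v j = 1 →
      ∑ j, v j • p j ∈ convexHull ℝ (Set.range p) := fun v hv hv1 =>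
    (convex_convexHull ℝ _).sum_mem (fun i _ => hv i) hv1
      fun i _ => subset_convexHull ℝ _ ⟨i, rfl⟩
  have hx := hmem w (fun i => (hw i).le) hw1
  rw [mem_intrinsicInterior]
  refine ⟨⟨_, subset_affineSpan ℝ _ hx⟩, ?_, rfl⟩
  rw [mem_interior]
  -- The functions `l i - c i` are the barycentric coordinates, so this is the open set where all of
  -- them are positive.
  refine ⟨{y | ∀ i, c i < l i y}, ?_, ?_, fun i => ?_⟩
  · rintro ⟨y, hy⟩ hpos
    have hy' := hy
    rw [affineSpan_convexHull] at hy'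
    obtain ⟨v, hv1, rfl⟩ := eq_affineCombination_of_mem_affineSpan_of_fintype hy'
    simp only [Set.mem_preimage]
    have h1 := Finset.affineCombination_eq_linear_combination univ p v hv1
    rw [h1]
    refine hmem v (fun i => ?_) hv1
    have h2 : c i < l i (univ.affineCombination ℝ p v) := hpos i
    rw [h1, hcomb v hv1] at h2
    linarith
  · simp only [Set.ofPred_forall]
    exact isOpen_iInter_of_finite fun i => isOpen_lt continuous_const
      (((l i).continuous_of_finiteDimensional).comp continuous_subtype_val)
  · change c i < l i (∑ j, w j • p j)
    rw [hcomb w hw1]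
    linarith [hw i]

/-- Each apex is outside the affine hull of B and all other apexes, a condition that persists when
apexes are dropped. -/
theorem isFoldPyramid_convexHull {B : Set E} (R : Finset E)
    (hR : ∀ r ∈ R, r ∉ affineSpan ℝ (B ∪ (R \ {r} : Set E))) :
    IsFoldPyramid (convexHull ℝ B) #R (convexHull ℝ (B ∪ R)) := by
  classical
  induction R using Finset.induction_on with
  | empty => simp [IsFoldPyramid]
  | insert r R hr ih =>
    rw [Finset.card_insert_of_notMem hr]
    refine ⟨convexHull ℝ (B ∪ R), ih fun s hs hs' => ?_, r, fun h => ?_, ?_⟩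
    · refine hR s (Finset.mem_insert_of_mem hs) (affineSpan_mono ℝ ?_ hs')
      refine Set.union_subset_union_right _ (Set.sdiff_subset_sdiff_left ?_)
      simp
    · rw [affineSpan_convexHull] at h
      refine hR r (Finset.mem_insert_self r R) (affineSpan_mono ℝ ?_ h)
      refine Set.union_subset_union_right _ fun s hs => ⟨by simpa using Or.inr hs, ?_⟩
      rintro rfl
      exact hr hs
    · rw [Set.insert_eq, convexHull_convexHull_union_right, Finset.coe_insert, Set.insert_eq]
      congr 1
      rw [Set.union_left_comm]

theorem affineIndependent_of_homogenization {ι : Type*} {g : ι → vertices P}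
    (h : LinearIndependent ℝ fun i => homogenization P (g i)) :
    AffineIndependent ℝ fun i => (g i : E) := by
  rw [affineIndependent_iff]
  intro s w hw hws i hi
  rw [linearIndependent_iff'] at h
  refine h s w (Subtype.ext ?_) i hi
  simp only [AddSubmonoidClass.coe_finsetSum, SetLike.val_smul, coe_homogenization]
  ext
  · simpa [Prod.fst_sum] using hws
  · simpa [Prod.snd_sum] using hw

theorem isSimplex_of_affineIndependent {ι : Type*} [Fintype ι] {p : ι → E} {k : ℕ}
    (hp : AffineIndependent ℝ p) (hk : Fintype.card ι = k + 1) :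
    IsSimplex k (convexHull ℝ (Set.range p)) := by
  classical
  refine ⟨univ.image p, ?_, ?_, by simp⟩
  · rw [Finset.card_image_of_injective _ hp.injective, Finset.card_univ, hk]
  · have := hp.range
    have hcoe : ((univ.image p : Finset E) : Set E) = Set.range p := by simp
    rw [← hcoe] at this
    exact this

/-- A dual basis vector, read as an affine function on E: the barycentric coordinate of r with
respect to the vertices other than z. -/
theorem exists_affine_indicator {z r : vertices P}
    (h : LinearIndependent ℝ fun a : {a // a ≠ z} => homogenization P a) (hr : r ≠ z) :
    ∃ (g : HomogenizationSpan P →ₗ[ℝ] ℝ) (l : E →ₗ[ℝ] ℝ) (c : ℝ),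
      (∀ a : vertices P, l a = c + g (homogenization P a)) ∧ g (homogenization P r) = 1 ∧
      ∀ a, a ≠ z → a ≠ r → g (homogenization P a) = 0 := by
  have h1 := h.notMem_span_image (s := {⟨r, hr⟩}ᶜ) (x := ⟨r, hr⟩) (by simp)
  obtain ⟨g, hg, hg'⟩ := Submodule.exists_le_ker_of_notMem h1
  obtain ⟨l, c, hlc⟩ := exists_affine_of_functional ((g (homogenization P r))⁻¹ • g)
  refine ⟨(g (homogenization P r))⁻¹ • g, l, c, fun a => by rw [hlc]; abel, ?_, fun a haz har => ?_⟩
  · simpa using inv_mul_cancel₀ hg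
  · have : g (homogenization P a) = 0 := hg' (Submodule.subset_span
      ⟨⟨a, haz⟩, by simpa using har, rfl⟩)
    simp [this]

/-- Divided by 1 + α = β₁ + β₂ + β₃, the relation exhibits one point as interior both to the segment
and to the triangle. -/
theorem isTriangularBipyramid_of_homogenization [FiniteDimensional ℝ E]
    {z v w₁ w₂ w₃ : vertices P} (hnd : [z, v, w₁, w₂, w₃].Nodup)
    (hli : LinearIndependent ℝ fun a : {a // a ≠ z} => homogenization P a)
    {α β₁ β₂ β₃ : ℝ} (hα : 0 < α) (h₁ : 0 < β₁) (h₂ : 0 < β₂) (h₃ : 0 < β₃)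
    (hrel : homogenization P z + α • homogenization P v = β₁ • homogenization P w₁ +
      β₂ • homogenization P w₂ + β₃ • homogenization P w₃) :
    IsTriangularBipyramid (convexHull ℝ {(v : E), (z : E), (w₁ : E), (w₂ : E), (w₃ : E)}) := by
  simp only [List.nodup_cons, List.mem_cons, List.not_mem_nil, or_false, not_or,
    List.nodup_nil, and_true, not_false_eq_true] at hnd
  obtain ⟨⟨hzv, hz1, hz2, hz3⟩, ⟨hv1, hv2, hv3⟩, ⟨h12, h13⟩, h23⟩ := hnd
  let W : Fin 3 → vertices P := ![w₁, w₂, w₃]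
  have hWz : ∀ i, W i ≠ z := by intro i; fin_cases i; exacts [Ne.symm hz1, Ne.symm hz2, Ne.symm hz3]
  have hWv : ∀ i, W i ≠ v := by intro i; fin_cases i; exacts [Ne.symm hv1, Ne.symm hv2, Ne.symm hv3]
  have hW : ∀ i j, W i = W j → i = j := by
    intro i j
    fin_cases i <;> fin_cases j <;> simp [W, h12, h13, h23, Ne.symm h12, Ne.symm h13, Ne.symm h23]
  have hrelE := congrArg (fun q : HomogenizationSpan P => (q : E × ℝ)) hrel
  simp only [Submodule.coe_add, SetLike.val_smul, coe_homogenization, Prod.smul_mk,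
    Prod.mk_add_mk, smul_eq_mul, mul_one, Prod.mk.injEq] at hrelE
  obtain ⟨hE, hsum⟩ := hrelE
  have hs : (0 : ℝ) < 1 + α := by linarith
  have hrange : Set.range (fun i => (W i : E)) = {(w₁ : E), (w₂ : E), (w₃ : E)} := by
    ext q; simp [W, Fin.exists_fin_succ, eq_comm]
  have hx : (1 + α)⁻¹ • ((z : E) + α • (v : E)) =
      ∑ i, ((1 + α)⁻¹ * ![β₁, β₂, β₃] i) • (W i : E) := by
    rw [hE, Fin.sum_univ_three]
    simp only [W, Matrix.cons_val_zero, Matrix.cons_val_one, Matrix.cons_val]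
    module
  have hint : (1 + α)⁻¹ • ((z : E) + α • (v : E)) ∈
      intrinsicInterior ℝ (convexHull ℝ (Set.range fun i => (W i : E))) := by
    choose g l c hlc hg1 hg0 using fun i => exists_affine_indicator hli (hWz i)
    rw [hx]
    refine mem_intrinsicInterior_convexHull (l := l) (c := c) (fun i j => ?_) (fun i => ?_) ?_
    · rw [hlc]
      split_ifs with hij
      · rw [← hij, hg1]
      · rw [hg0 i _ (hWz j) fun h => hij (hW j i h).symm]
    · refine mul_pos (inv_pos.2 hs) ?_
      fin_cases i
      exacts [h₁, h₂, h₃]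
    · rw [← Finset.mul_sum, Fin.sum_univ_three]
      simp only [Matrix.cons_val_zero, Matrix.cons_val_one, Matrix.cons_val]
      rw [← hsum, inv_mul_cancel₀ hs.ne']
  have hopen : (1 + α)⁻¹ • ((z : E) + α • (v : E)) ∈ openSegment ℝ (v : E) (z : E) := by
    refine ⟨α * (1 + α)⁻¹, (1 + α)⁻¹, by positivity, by positivity, ?_, by module⟩
    field_simp
    ring
  refine ⟨convexHull ℝ (Set.range fun i => (W i : E)), v, z, _,
    isSimplex_of_affineIndependent (affineIndependent_of_homogenization ?_) (by simp),
    fun h => hzv (Subtype.ext h.symm), ?_, hopen, hint, ?_⟩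
  · exact hli.comp (fun i => (⟨W i, hWz i⟩ : {a // a ≠ z}))
      fun i j h => hW i j (congrArg Subtype.val h)
  · apply subset_antisymm
    · rintro _ ⟨⟨s, t, hs0, ht0, hst, rfl⟩, hT⟩
      -- The coordinate of v vanishes on the triangle and runs from 1 at v to -α at z, so it has one
      -- zero on the segment.
      obtain ⟨g, l, c, hlc, hg1, hg0⟩ := exists_affine_indicator hli (Ne.symm hzv)
      have hl : l (s • (v : E) + t • (z : E)) = c := by
        refine convexHull_min (t := {q | l q = c}) ?_ (convex_hyperplane l.isLinear c) hT
        rintro _ ⟨i, rfl⟩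
        rw [Set.mem_ofPred_eq, hlc, hg0 _ (hWz i) (hWv i), add_zero]
      have hgz : g (homogenization P z) = -α := by
        have := congrArg g hrel
        simp only [map_add, map_smul, smul_eq_mul, hg1, hg0 w₁ (hWz 0) (hWv 0),
          hg0 w₂ (hWz 1) (hWv 1), hg0 w₃ (hWz 2) (hWv 2)] at this
        linarith
      rw [map_add, map_smul, map_smul, hlc, hlc, hg1, hgz, smul_eq_mul, smul_eq_mul] at hl
      have h4 : s = t * α := by linear_combination hl - c * hst
      have h5 : t = (1 + α)⁻¹ := eq_inv_of_mul_eq_one_left (by linear_combination hst - h4)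
      rw [Set.mem_singleton_iff, h4, h5]
      module
    · rintro _ rfl
      exact ⟨openSegment_subset_segment _ _ _ hopen, intrinsicInterior_subset hint⟩
  · rw [hrange]
    have : ∀ T : Set E, insert (v : E) (insert (z : E) T) = {(v : E), (z : E)} ∪ T := by
      intro T; ext q; simp [or_assoc]
    rw [this, this, convexHull_convexHull_union_right]

theorem IsSimplicial.encard_vertices_le [FiniteDimensional ℝ E] (hP : IsPolytope d P) (hd : 2 ≤ d)
    (hS : IsSimplicial 2 P) (hcard : (facets P).encard ≤ (d : ℕ∞) + 3) :
    (vertices P).encard ≤ (d : ℕ∞) + 2 := by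
  classical
  have hfin : Fintype (vertices P) := hP.finite_vertices.fintype
  have hrank := finrank_homogenizationSpan hP
  have h : Fintype.card (vertices P) ≤ d + 2 := by
    rcases hS.isBasisOrBipyramidal hP hd hcard with ⟨-, h⟩ | ⟨_, _, _, _, _, -, -, h, -⟩ <;> omega
  rw [← Set.coe_fintypeCard]
  exact_mod_cast h

theorem IsSimplicial.isSimplex_or_isFoldPyramid [FiniteDimensional ℝ E] (hP : IsPolytope d P)
    (hd : 2 ≤ d) (hS : IsSimplicial 2 P) (hcard : (facets P).encard ≤ (d : ℕ∞) + 3) :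
    IsSimplex d P ∨ ∃ B : Set E, IsTriangularBipyramid B ∧ IsFoldPyramid B (d - 3) P := by
  classical
  have hfin : Fintype (vertices P) := hP.finite_vertices.fintype
  have hrank := finrank_homogenizationSpan hP
  rcases hS.isBasisOrBipyramidal hP hd hcard with
    ⟨hli, hc⟩ | ⟨z, v, w₁, w₂, w₃, hnd, hli, hc, α, β₁, β₂, β₃, hα, h₁, h₂, h₃, hrel⟩
  · left
    have h1 := isSimplex_of_affineIndependent (k := d)
      (affineIndependent_of_homogenization (g := id) hli) (by omega)
    simp only [id, Subtype.range_coe_subtype, Set.ofPred_mem_eq] at h1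
    rwa [hP.convexHull_vertices] at h1
  · right
    refine ⟨_, isTriangularBipyramid_of_homogenization hnd hli hα h₁ h₂ h₃ hrel, ?_⟩
    let L : Finset (vertices P) := [z, v, w₁, w₂, w₃].toFinset
    have hL : #L = 5 := List.toFinset_card_of_nodup hnd
    have hmemL : ∀ a, a ∈ L ↔ a = v ∨ a = z ∨ a = w₁ ∨ a = w₂ ∨ a = w₃ := by
      intro a
      simp only [L, List.mem_toFinset, List.mem_cons, List.not_mem_nil, or_false]
      tauto
    let R : Finset E := (Lᶜ).map (Function.Embedding.subtype _)
    -- There are d + 2 vertices, five of which span the bipyramid.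
    have hR : #R = d - 3 := by
      rw [Finset.card_map, Finset.card_compl, hL, hc, hrank]
      omega
    have hB : ({(v : E), (z : E), (w₁ : E), (w₂ : E), (w₃ : E)} : Set E) =
        (fun a : vertices P => (a : E)) '' (L : Set (vertices P)) := by
      ext q
      simp only [Set.mem_insert_iff, Set.mem_singleton_iff, Set.mem_image, Finset.mem_coe, hmemL]
      constructor
      · rintro (rfl | rfl | rfl | rfl | rfl)
        exacts [⟨v, by simp, rfl⟩, ⟨z, by simp, rfl⟩, ⟨w₁, by simp, rfl⟩, ⟨w₂, by simp, rfl⟩,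
          ⟨w₃, by simp, rfl⟩]
      · rintro ⟨a, rfl | rfl | rfl | rfl | rfl, rfl⟩ <;> simp
    have hRcoe : (R : Set E) =
        (fun a : vertices P => (a : E)) '' ((Lᶜ : Finset (vertices P)) : Set (vertices P)) := by
      simp [R]
    have hP' : P = convexHull ℝ
        ({(v : E), (z : E), (w₁ : E), (w₂ : E), (w₃ : E)} ∪ (R : Set E)) := by
      rw [hB, hRcoe, ← Set.image_union, ← Finset.coe_union, Finset.union_compl, Finset.coe_univ,
        Set.image_univ, Subtype.range_coe, hP.convexHull_vertices]
    conv_rhs => rw [hP']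
    rw [← hR]
    refine isFoldPyramid_convexHull R fun r hr => ?_
    obtain ⟨r, hrL, rfl⟩ := Finset.mem_map.1 hr
    rw [Finset.mem_compl, hmemL] at hrL
    push Not at hrL
    obtain ⟨hrv, hrz, hr1, hr2, hr3⟩ := hrL
    have hnd' := hnd
    simp only [List.nodup_cons, List.mem_cons, List.not_mem_nil, or_false, not_or] at hnd'
    obtain ⟨⟨hzv, hz1, hz2, hz3⟩, -⟩ := hnd'
    obtain ⟨g, l, c, hlc, hg1, hg0⟩ := exists_affine_indicator hli hrz
    -- The relation does not involve r, so the coordinate of r vanishes at z as well, hence at every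
    -- vertex but r.
    have hgz : g (homogenization P z) = 0 := by
      have := congrArg g hrel
      simpa only [map_add, map_smul, smul_eq_mul, hg0 v (Ne.symm hzv) hrv.symm,
        hg0 w₁ (Ne.symm hz1) hr1.symm, hg0 w₂ (Ne.symm hz2) hr2.symm,
        hg0 w₃ (Ne.symm hz3) hr3.symm, mul_zero, add_zero] using this
    have hga : ∀ a, a ≠ r → l (a : E) = c := by
      intro a har
      rw [hlc]
      by_cases haz : a = z
      · rw [haz, hgz, add_zero]
      · rw [hg0 a haz har, add_zero]
    refine notMem_affineSpan_of_functional (l := l) (c := c) ?_ ?_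
    · rw [hB, hRcoe]
      rintro _ (⟨a, ha, rfl⟩ | ⟨⟨a, -, rfl⟩, ha⟩)
      · refine hga a fun h => ?_
        rw [h, Finset.mem_coe, hmemL] at ha
        tauto
      · exact hga a fun h => ha (by rw [h]; rfl)
    · change l (r : E) ≠ c
      rw [hlc, hg1]
      simp

end Bipyramid

/-! ### The cone of edge directions at a vertex of a 2-neighborly polytope. -/

section Neighborly

variable {E : Type*} [NormedAddCommGroup E] [NormedSpace ℝ E] {d : ℕ} {P : Set E}

theorem IsTwoNeighborly.exists_functional (hN : IsTwoNeighborly P) {v w : E} (hv : v ∈ vertices P)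
    (hw : w ∈ vertices P) (hvw : v ≠ w) : ∃ l : E →ₗ[ℝ] ℝ, l w = l v ∧
      ∀ p ∈ vertices P, p ≠ v → p ≠ w → l p < l v := by
  obtain ⟨l, hl⟩ := (hN v hv w hw hvw).isExposed ⟨v, left_mem_segment ℝ v w⟩
  have hmem : ∀ p, p ∈ segment ℝ v w ↔ p ∈ P ∧ ∀ y ∈ P, l y ≤ l p := by
    intro p
    rw [hl]
    rfl
  obtain ⟨hvP, hvmax⟩ := (hmem v).1 (left_mem_segment ℝ v w)
  obtain ⟨hwP, hwmax⟩ := (hmem w).1 (right_mem_segment ℝ v w)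
  refine ⟨l, le_antisymm (hvmax w hwP) (hwmax v hvP), fun p hp hpv hpw => ?_⟩
  refine lt_of_le_of_ne (hvmax p hp.1) fun h => ?_
  have hseg : p ∈ segment ℝ v w := (hmem p).2 ⟨hp.1, fun y hy => (hvmax y hy).trans h.ge⟩
  exact not_wbtw_of_vertices hv hp hw hpv.symm hpw (mem_segment_iff_wbtw.1 hseg)

/-- Any five vertices of a 2-neighborly polytope are affinely independent. -/
theorem IsTwoNeighborly.affineIndependent (hP : IsPolytope d P) (hN : IsTwoNeighborly P)
    {ι : Type*} [Fintype ι] {p : ι → E} (hinj : Function.Injective p)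
    (hp : ∀ i, p i ∈ vertices P) (hcard : Fintype.card ι ≤ 5) : AffineIndependent ℝ p := by
  classical
  by_contra hcon
  obtain ⟨I, hI⟩ := Convex.radon_partition hcon
  -- A vertex or an edge is a face, so it cannot meet the hull of the other vertices. Of five
  -- points, one side of a Radon partition has at most two.
  have key : ∀ I : Set ι, I.ncard ≤ 2 →
      ¬ (convexHull ℝ (p '' I) ∩ convexHull ℝ (p '' Iᶜ)).Nonempty := by
    rintro I hI ⟨q, hq, hq'⟩
    have h0 : I.ncard ≠ 0 := by
      intro h
      rw [Set.ncard_eq_zero] at h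
      simp [h] at hq
    obtain h1 | h2 : I.ncard = 1 ∨ I.ncard = 2 := by omega
    · obtain ⟨a, rfl⟩ := Set.ncard_eq_one.1 h1
      rw [Set.image_singleton, convexHull_singleton, Set.mem_singleton_iff] at hq
      subst hq
      refine (hP.convex.mem_extremePoints_iff_mem_sdiff_convexHull_sdiff.1 (hp a)).2
        (convexHull_mono ?_ hq')
      rintro _ ⟨i, hi, rfl⟩
      exact ⟨(hp i).1, fun h => hi (hinj h)⟩
    · obtain ⟨a, b, hab, rfl⟩ := Set.ncard_eq_two.1 h2
      obtain ⟨l, hl, hlt⟩ := hN.exists_functional (hp a) (hp b) (hinj.ne hab)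
      rw [Set.image_pair] at hq
      have e1 : l q = l (p a) := by
        refine convexHull_min (t := {y | l y = l (p a)}) ?_ (convex_hyperplane l.isLinear _) hq
        rintro _ (rfl | rfl)
        exacts [rfl, hl]
      have e2 : l q < l (p a) := by
        refine convexHull_min (t := {y | l y < l (p a)}) ?_ (convex_halfSpace_lt l.isLinear _) hq'
        rintro _ ⟨i, hi, rfl⟩
        simp only [Set.mem_compl_iff, Set.mem_insert_iff, Set.mem_singleton_iff, not_or] at hi
        exact hlt _ (hp i) (hinj.ne hi.1) (hinj.ne hi.2)
      exact e2.ne e1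
  have hsum := Set.ncard_add_ncard_compl I
  rw [Nat.card_eq_fintype_card] at hsum
  rcases le_or_gt I.ncard 2 with h | h
  · exact key I h hI
  · refine key Iᶜ (by omega) ?_
    rwa [compl_compl, Set.inter_comm]

/-- The direction from the vertex `v` to another vertex. -/
def edgeDirection (v : vertices P) (a : {a : vertices P // a ≠ v}) : vectorSpan ℝ P :=
  ⟨(a : E) - (v : E), vsub_mem_vectorSpan ℝ a.1.2.1 v.2.1⟩

theorem coe_edgeDirection (v : vertices P) (a : {a : vertices P // a ≠ v}) :
    (edgeDirection v a : E) = (a : E) - (v : E) := rfl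

theorem finrank_span_edgeDirection (v : vertices P) (S : Set {a : vertices P // a ≠ v}) :
    finrank ℝ (Submodule.span ℝ (edgeDirection v '' S)) =
      finrank ℝ (vectorSpan ℝ (insert (v : E) ((fun a => (a.1 : E)) '' S))) := by
  rw [← finrank_span_image_of_injective (vectorSpan ℝ P).subtype_injective,
    vectorSpan_eq_span_vsub_set_right_ne ℝ (Set.mem_insert _ _), Set.insert_sdiff_self_of_notMem,
    Set.image_image]
  · rfl
  · rintro ⟨a, -, ha⟩
    exact a.2 (Subtype.ext ha)

theorem span_range_edgeDirection (hP : IsPolytope d P) (v : vertices P) :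
    Submodule.span ℝ (Set.range (edgeDirection v)) = ⊤ := by
  apply Submodule.map_injective_of_injective (vectorSpan ℝ P).subtype_injective
  rw [Submodule.map_span, Submodule.map_subtype_top, ← Set.range_comp]
  have h1 : vectorSpan ℝ P = vectorSpan ℝ (vertices P) := by
    conv_lhs => rw [← hP.convexHull_vertices]
    rw [← direction_affineSpan, affineSpan_convexHull, direction_affineSpan]
  have h2 : vectorSpan ℝ (vertices P) =
      Submodule.span ℝ ((· -ᵥ (v : E)) '' (vertices P \ {(v : E)})) :=
    vectorSpan_eq_span_vsub_set_right_ne ℝ v.2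
  refine Eq.trans (congrArg _ ?_) (h1.trans h2).symm
  ext q
  constructor
  · rintro ⟨a, rfl⟩
    exact ⟨a, ⟨a.1.2, fun h => a.2 (Subtype.ext h)⟩, rfl⟩
  · rintro ⟨a, ⟨ha, hav⟩, rfl⟩
    exact ⟨⟨⟨a, ha⟩, fun h => hav (congrArg Subtype.val h)⟩, rfl⟩

/-- The functional exposing the edge from v to a kills that direction and is negative on all others,
so every coefficient would be zero. -/
theorem IsTwoNeighborly.edgeDirection_independent (hN : IsTwoNeighborly P) [Fintype (vertices P)]
    [DecidableEq (vertices P)] (v : vertices P) (a : {a : vertices P // a ≠ v})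
    (c : {a : vertices P // a ≠ v} → ℝ) (hc : ∀ b, 0 ≤ c b) (hca : c a = 0) :
    ∑ b, c b • edgeDirection v b ≠ edgeDirection v a := by
  intro h
  have h1 := congrArg (vectorSpan ℝ P).subtype h
  simp only [map_sum, map_smul, Submodule.subtype_apply, coe_edgeDirection] at h1
  obtain ⟨l, hl, hlt⟩ := hN.exists_functional v.2 a.1.2 fun h => a.2 (Subtype.ext h.symm)
  have h2 := congrArg l h1
  simp only [map_sum, map_smul, map_sub, smul_eq_mul, hl, sub_self] at h2
  have hneg : ∀ b : {a : vertices P // a ≠ v}, b ≠ a → l b - l v < 0 := fun b hb =>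
    sub_neg.2 (hlt b b.1.2 (fun h => b.2 (Subtype.ext h)) fun h => hb (Subtype.ext (Subtype.ext h)))
  have h3 : ∀ b ∈ univ, c b * (l b - l v) ≤ 0 := by
    intro b _
    by_cases hb : b = a
    · rw [hb, hca, zero_mul]
    · exact mul_nonpos_of_nonneg_of_nonpos (hc b) (hneg b hb).le
  rw [Finset.sum_eq_zero_iff_of_nonpos h3] at h2
  have h4 : ∀ b, c b = 0 := by
    intro b
    by_cases hb : b = a
    · rw [hb, hca]
    · exact (mul_eq_zero.1 (h2 b (mem_univ b))).resolve_right (hneg b hb).ne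
  simp only [h4, zero_smul, Finset.sum_const_zero] at h1
  exact a.2 (Subtype.ext (sub_eq_zero.1 h1.symm))

/-- The functionals exposing two distinct edges at v vanish on different directions, so their
negated sum is positive on all. -/
theorem IsTwoNeighborly.exists_height (hN : IsTwoNeighborly P) (v : vertices P)
    {a b : {a : vertices P // a ≠ v}} (hab : a ≠ b) :
    ∃ h : vectorSpan ℝ P →ₗ[ℝ] ℝ, ∀ p, 0 < h (edgeDirection v p) := by
  have key : ∀ a : {a : vertices P // a ≠ v}, ∃ l : E →ₗ[ℝ] ℝ,
      (∀ p : {a : vertices P // a ≠ v}, l p ≤ l v) ∧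
      ∀ p : {a : vertices P // a ≠ v}, p ≠ a → l p < l v := by
    intro a
    obtain ⟨l, hl, hlt⟩ := hN.exists_functional v.2 a.1.2 fun h => a.2 (Subtype.ext h.symm)
    have hlt' : ∀ p : {a : vertices P // a ≠ v}, p ≠ a → l p < l v := fun p hp =>
      hlt p p.1.2 (fun h => p.2 (Subtype.ext h)) fun h => hp (Subtype.ext (Subtype.ext h))
    refine ⟨l, fun p => ?_, hlt'⟩
    by_cases hp : p = a
    · rw [hp, hl]
    · exact (hlt' p hp).le
  obtain ⟨l, hl, hla⟩ := key a
  obtain ⟨k, hk, hkb⟩ := key b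
  refine ⟨-((l + k) ∘ₗ (vectorSpan ℝ P).subtype), fun p => ?_⟩
  simp only [LinearMap.neg_apply, LinearMap.comp_apply, Submodule.subtype_apply,
    coe_edgeDirection, LinearMap.add_apply, map_sub]
  have h1 := hl p
  have h2 := hk p
  by_cases hp : p = a
  · have := hkb p fun h => hab (hp.symm.trans h)
    linarith
  · have := hla p hp
    linarith

/-- Four directions in a 3-dimensional space would make v and four other vertices affinely
dependent. -/
theorem IsTwoNeighborly.facesTriangular (hP : IsPolytope d P) (hN : IsTwoNeighborly P)
    [FiniteDimensional ℝ E] [Fintype (vertices P)] [DecidableEq (vertices P)] (v : vertices P)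
    {ι : Type*} (f : ι → vectorSpan ℝ P →ₗ[ℝ] ℝ) :
    FacesTriangular (edgeDirection v) f := by
  intro S e₁ e₂ e₃ he p q r s hnodup hp hq hr hs
  let g : Fin 5 → vertices P := ![v, p, q, r, s]
  have hginj : Function.Injective g := by
    have : [v, p.1, q.1, r.1, s.1].Nodup := by
      refine List.nodup_cons.2 ⟨?_, hnodup.map Subtype.val_injective⟩
      simp only [List.mem_cons, List.not_mem_nil, or_false, not_or]
      exact ⟨p.2.symm, q.2.symm, r.2.symm, s.2.symm⟩
    exact List.nodup_ofFn.1 (by simpa [List.ofFn_succ, g] using this)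
  have hind : AffineIndependent ℝ fun i => (g i : E) :=
    hN.affineIndependent hP (Subtype.val_injective.comp hginj) (fun i => (g i).2) (by simp)
  have h1 := hind.finrank_vectorSpan (n := 4) (by simp)
  have hsub : Set.range (fun i => (g i : E)) ⊆
      insert (v : E) ((fun a => (a.1 : E)) '' {a | ∀ i ∈ S, f i (edgeDirection v a) = 0}) := by
    rintro _ ⟨i, rfl⟩
    fin_cases i
    · exact Set.mem_insert _ _
    · exact Or.inr ⟨p, hp, rfl⟩
    · exact Or.inr ⟨q, hq, rfl⟩
    · exact Or.inr ⟨r, hr, rfl⟩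
    · exact Or.inr ⟨s, hs, rfl⟩
  have h2 := Submodule.finrank_mono (vectorSpan_mono ℝ hsub)
  rw [h1, ← finrank_span_edgeDirection] at h2
  have h3 : Submodule.span ℝ (edgeDirection v '' {a | ∀ i ∈ S, f i (edgeDirection v a) = 0}) ≤
      Submodule.span ℝ ({e₁, e₂, e₃} : Set (vectorSpan ℝ P)) := by
    rw [Submodule.span_le]
    rintro _ ⟨a, ha, rfl⟩
    obtain ⟨t₁, t₂, t₃, h⟩ := he a ha
    rw [h]
    refine Submodule.add_mem _ (Submodule.add_mem _ ?_ ?_) ?_ <;>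
      exact Submodule.smul_mem _ _ (Submodule.subset_span (by simp))
  have h4 : finrank ℝ (Submodule.span ℝ ({e₁, e₂, e₃} : Set (vectorSpan ℝ P))) ≤ 3 := by
    classical
    have := finrank_span_finset_le_card (R := ℝ) ({e₁, e₂, e₃} : Finset (vectorSpan ℝ P))
    simp only [Finset.coe_insert, Finset.coe_singleton] at this
    exact this.trans Finset.card_le_three
  have := Submodule.finrank_mono h3
  omega

/-- The facets of the cone generated by the edge directions at `v` come from facets containing
`v`. -/
theorem card_facetSets_edgeDirection_le [FiniteDimensional ℝ E] [Fintype (vertices P)]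
    [DecidableEq (vertices P)] (hP : IsPolytope d P) (v : vertices P) :
    ENat.card {S : Finset {a : vertices P // a ≠ v} // IsFacetSet (edgeDirection v) S} ≤
      {F ∈ facets P | (v : E) ∈ F}.encard := by
  have hext : ∀ S : {S : Finset {a : vertices P // a ≠ v} // IsFacetSet (edgeDirection v) S},
      ∃ l : E →ₗ[ℝ] ℝ, ∀ a : {a : vertices P // a ≠ v},
        l (a : E) = l v + S.2.functional (edgeDirection v a) := by
    intro S
    obtain ⟨l, hl⟩ := LinearMap.exists_extend S.2.functional
    refine ⟨l, fun a => ?_⟩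
    rw [← hl, LinearMap.comp_apply, Submodule.subtype_apply, coe_edgeDirection, map_sub]
    abel
  choose l hl using hext
  have hzero : ∀ (S : {S : Finset {a : vertices P // a ≠ v} // IsFacetSet (edgeDirection v) S})
      (a : {a : vertices P // a ≠ v}), l S (a : E) = l S v ↔ a ∈ S.1 := by
    intro S a
    rw [hl, add_eq_left, S.2.functional_eq_zero]
  have hle : ∀ S, ∀ p ∈ vertices P, l S v ≤ l S p := by
    intro S p hp
    by_cases hpv : p = v
    · rw [hpv]
    · rw [hl S ⟨⟨p, hp⟩, fun h => hpv (congrArg Subtype.val h)⟩]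
      exact le_add_of_nonneg_right (S.2.functional_nonneg _)
  let Φ : {S : Finset {a : vertices P // a ≠ v} // IsFacetSet (edgeDirection v) S} → Set E :=
    fun S => {p ∈ P | l S p = l S v}
  have hinj : Function.Injective Φ := by
    intro S S' h
    refine Subtype.ext (Finset.ext fun a => ?_)
    have := Set.ext_iff.1 h a
    simp only [Φ, Set.mem_sep_iff, a.1.2.1, true_and] at this
    rw [← hzero, this, hzero]
  refine hinj.encard_range.trans (Set.encard_le_encard ?_)
  rintro _ ⟨S, rfl⟩
  have himage : {p ∈ vertices P | l S p = l S v} =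
      insert (v : E) ((fun a => (a.1 : E)) '' (S.1 : Set {a : vertices P // a ≠ v})) := by
    ext p
    constructor
    · rintro ⟨hp, hpc⟩
      by_cases hpv : p = v
      · exact Or.inl hpv
      · exact Or.inr ⟨⟨⟨p, hp⟩, fun h => hpv (congrArg Subtype.val h)⟩, (hzero S _).1 hpc, rfl⟩
    · rintro (rfl | ⟨a, ha, rfl⟩)
      · exact ⟨v.2, rfl⟩
      · exact ⟨a.1.2, (hzero S a).2 ha⟩
  refine ⟨mem_facets_of_le hP (hle S) ⟨v, v.2, rfl⟩ ?_, v.2.1, rfl⟩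
  rw [himage, ← finrank_span_edgeDirection, S.2.finrank_span, hP.finrank_eq]

theorem IsTwoNeighborly.le_encard_facets [FiniteDimensional ℝ E] (hP : IsPolytope d P)
    (hN : IsTwoNeighborly P) (hcard : (d : ℕ∞) + 3 ≤ (vertices P).encard) {v : E}
    (hv : v ∈ vertices P) : (d : ℕ∞) + 3 ≤ {F ∈ facets P | v ∈ F}.encard := by
  classical
  have hfin : Fintype (vertices P) := hP.finite_vertices.fintype
  rw [← Set.coe_fintypeCard] at hcard
  have hn : d + 3 ≤ Fintype.card (vertices P) := by exact_mod_cast hcard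
  -- For d ≤ 3, some d + 2 ≤ 5 vertices would be affinely independent in dimension d.
  have hd : 4 ≤ d := by
    by_contra! hd
    obtain ⟨t, -, ht⟩ := Finset.exists_subset_card_eq
      (s := (univ : Finset (vertices P))) (n := d + 2) (by rw [Finset.card_univ]; omega)
    have hind : AffineIndependent ℝ fun a : t => (a.1 : E) :=
      hN.affineIndependent hP (Subtype.val_injective.comp Subtype.val_injective)
        (fun a => a.1.2) (by rw [Fintype.card_coe]; omega)
    have h1 := hind.card_le_finrank_succ
    have h2 := Submodule.finrank_mono (vectorSpan_mono ℝ (show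
      Set.range (fun a : t => (a.1 : E)) ⊆ P
      by rintro _ ⟨a, rfl⟩; exact a.1.2.1))
    rw [Fintype.card_coe] at h1
    rw [hP.finrank_eq] at h2
    omega
  by_contra! hlt
  lift v to vertices P using hv
  have hcardA : Fintype.card {a : vertices P // a ≠ v} + 1 = Fintype.card (vertices P) := by
    rw [Fintype.card_subtype_compl, Fintype.card_subtype_eq]
    omega
  obtain ⟨a, b, hab⟩ := Fintype.exists_pair_of_one_lt_card
    (show 1 < Fintype.card {a : vertices P // a ≠ v} by omega)
  obtain ⟨h, hh⟩ := hN.exists_height v hab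
  have F := facetSystem (span_range_edgeDirection hP v) hh (hN.edgeDirection_independent v)
  have hι := Fintype.ofFinite
    {S : Finset {a : vertices P // a ≠ v} // IsFacetSet (edgeDirection v) S}
  have hne : Nonempty {a : vertices P // a ≠ v} := ⟨a⟩
  have hle : Fintype.card
      {S : Finset {a : vertices P // a ≠ v} // IsFacetSet (edgeDirection v) S} ≤ d + 2 := by
    have h1 := (card_facetSets_edgeDirection_le hP v).trans_lt hlt
    rw [ENat.card_eq_coe_fintype_card] at h1
    have h2 : Fintype.card
      {S : Finset {a : vertices P // a ≠ v} // IsFacetSet (edgeDirection v) S} < d + 3 := by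
      exact_mod_cast h1
    omega
  have hrank := hP.finrank_eq
  rcases F.isBasisOrBipyramidal (hN.facesTriangular hP v _) (by omega) (by omega) with
    ⟨-, h⟩ | ⟨_, _, _, _, _, -, -, h, -⟩ <;> omega

end Neighborly

end Polytopes

theorem mainTheorem5 {E : Type*} [NormedAddCommGroup E] [NormedSpace ℝ E]
    [FiniteDimensional ℝ E] (d : ℕ) (P : Set E) (hP : Polytopes.IsPolytope d P) :
    (3 ≤ d → Polytopes.IsSimplicial 2 P →
      ((d : ℕ∞) + 3 ≤ (Polytopes.vertices P).encard →
        (d : ℕ∞) + 4 ≤ (Polytopes.facets P).encard) ∧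
      ((Polytopes.facets P).encard ≤ (d : ℕ∞) + 3 →
        Polytopes.IsSimplex d P ∨
          ∃ B : Set E, Polytopes.IsTriangularBipyramid B ∧
            Polytopes.IsFoldPyramid B (d - 3) P)) ∧
    (Polytopes.IsTwoNeighborly P → (d : ℕ∞) + 3 ≤ (Polytopes.vertices P).encard →
      ∀ v ∈ Polytopes.vertices P,
        (d : ℕ∞) + 3 ≤ {F ∈ Polytopes.facets P | v ∈ F}.encard) := by
  refine ⟨fun hd hS => ⟨fun hn => ?_, hS.isSimplex_or_isFoldPyramid hP (by omega)⟩,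
    fun hN hn v hv => hN.le_encard_facets hP hn hv⟩
  -- Having at most d + 3 facets would leave at most d + 2 vertices.
  by_contra! hlt
  have h1 : (Polytopes.facets P).encard ≤ (d : ℕ∞) + 3 := by
    refine Order.lt_add_one_iff_of_not_isMax ?_ |>.1 ?_
    · exact not_isMax_iff_ne_top.2 (by exact_mod_cast ENat.natCast_ne_top (d + 3))
    · rwa [add_assoc, show (3 : ℕ∞) + 1 = 4 by norm_num]
  have h2 := hn.trans (hS.encard_vertices_le hP (by omega) h1)
  have h3 : d + 3 ≤ d + 2 := by exact_mod_cast h2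
  omega
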